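/- Let $n\ge 1$, let $L_1,\dots,L_n\in\mathbb R\setminus\{0\}$, and let $G$ be the anisotropic Heisenberg group: $\mathbb R^{2n+1}$ with coordinates $(x_1,\dots,x_{2n},t)$ and group law $$(x,t)*(y,s)=\Big(x+y,\;t+s+\sum_{j=1}^n L_j\,(x_jy_{j+n}-y_jx_{j+n})\Big),$$ with identity $e=0$. Then the fields $$X_j=\partial_{x_j}-L_jx_{j+n}\partial_t,\qquad X_{j+n}=\partial_{x_{j+n}}+L_jx_j\partial_t\quad(1\le j\le n),\qquad T=\partial_t$$ are left-invariant on $G$, and they form a basis of its Lie algebra $\mathfrak g$. Give $\mathfrak g$ the inner product for which this basis is orthogonal with $$w_j:=\|X_j\|^2=2|L_j|,\qquad w_{j+n}:=\|X_{j+n}\|^2=2|L_j|\quad(1\le j\le n),\qquad \|T\|^2=1 .$$ For a function $f$ write $\nabla_0 f=\sum_{i=1}^{2n} w_i^{-1}(X_if)X_i$ for the horizontal gradient, so that $\langle\nabla_0f,\nabla_0g\rangle=\sum_i w_i^{-1}X_if\,X_ig$, and $$\Delta_p f=\operatorname{div}\big(\|\nabla_0f\|^{p-2}\nabla_0f\big)\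 (1<p<\infty),\qquad \Delta_\infty f=\sum_{i,j=1}^{2n}\frac{1}{w_iw_j}\,X_iX_jf\;X_if\;X_jf .$$ Let $Q=2n+2$ be the homogeneous dimension, integrate with respect to Lebesgue measure, and put $$\rho(x,t)=\Big(\Big(\sum_{i=1}^n2|L_i|x_i^2+\sum_{i=n+1}^{2n}2|L_{i-n}|x_i^2\Big)^2+16t^2\Big)^{1/4},\qquad \omega_p=\int_{\{\rho<1\}}\|\nabla_0\rho\|^p,$$ $$\Gamma_p=\begin{cases}C_p\,\rho^{(p-Q)/(p-1)},\quad C_p=\frac{p-1}{p-Q}(Q\omega_p)^{-1/(p-1)},& p\ne Q,\\[2pt] C_p\log\rho,\quad C_p=(Q\omega_p)^{-1/(p-1)},&p=Q.\end{cases}$$ Then: 1. $G$ is a group of Heisenberg type with respect to this inner product. That is, $G$ is a Carnot group (simply connected, with stratification $\mathfrak g=V_1\oplus V_2$, $V_1=\operatorname{span}\{X_1,\dots,X_{2n}\}$, $V_2=\operatorname{span}\{T\}$, $[V_1,V_1]=V_2$, $[V_1,V_2]=0$), and, with $Z$ the center of $\mathfrak g$, one has $[Z^\perp,Z^\perp]=Z$,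 and for every $z\in Z$ with $\|z\|=1$ the map $J_z:Z^\perp\to Z^\perp$ defined by $\langle J_zv,w\rangle=\langle z,[v,w]\rangle$ for all $w\in Z^\perp$ is orthogonal. 2. For every $1<p<\infty$, $\Gamma_p$ is a fundamental solution of the $p$-Laplace equation with singularity at $e$. That is, $\Gamma_p\in W^{1,p}_{\mathrm{loc}}(G\setminus\{e\})$ (horizontal Sobolev space), $\|\nabla_0\Gamma_p\|^{p-1}\in L^1_{\mathrm{loc}}(G)$, and $\Delta_p\Gamma_p=\delta_e$ in the sense that $$\int_G\|\nabla_0\Gamma_p\|^{p-2}\langle\nabla_0\Gamma_p,\nabla_0\varphi\rangle=-\varphi(e)\qquad\text{for all }\varphi\in C_c^\infty(G).$$ 3. $\rho$ is $C^\infty$ on $G\setminus\{e\}$ and $\Delta_\infty\rho=0$ there. 4. $G$ is polarizable: if $u_2$ is Folland's solution, i.e. the function that is smooth and positive on $G\setminus\{e\}$, is homogeneous of degree $2-Q$ for the dilations $(x,t)\mapsto(rx,r^2t)$, and satisfies $-\Delta_2u_2=\delta_e$ (that is, $-u_2$ is a fundamental solution for $p=2$ in the sense of 2), then such a function exists and $N=u_2^{1/(2-Q)}$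 satisfies $\Delta_\infty N=0$ on $G\setminus\{e\}$. -/

import Mathlib

open MeasureTheory Set
open scoped Manifold ContDiff ENNReal

noncomputable section

/-! ### Carnot groups and groups of Heisenberg type -/

/-- `V 1, V 2, …` is a stratification of the real Lie algebra `𝔤` of step at most `k`:
`𝔤 = V 1 ⊕ ⋯ ⊕ V k`, `[V 1, V j] = V (j + 1)` for all `j ≥ 1`, and `V j = 0` for `j > k`. -/
structure IsStratification {𝔤 : Type*} [LieRing 𝔤] [LieAlgebra ℝ 𝔤] (k : ℕ)
    (V : ℕ → Submodule ℝ 𝔤) : Prop where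
  isInternal : DirectSum.IsInternal (fun i : Fin k => V (i + 1))
  bracket_eq : ∀ j, 1 ≤ j →
    Submodule.span ℝ {u : 𝔤 | ∃ x ∈ V 1, ∃ y ∈ V j, ⁅x, y⁆ = u} = V (j + 1)
  eq_bot : ∀ j, k < j → V j = ⊥

/-- A Carnot group of step at most `k` with stratification `V`: a simply connected
finite-dimensional Lie group with a stratified Lie algebra. -/
structure IsCarnotGroup {E : Type*} [NormedAddCommGroup E] [NormedSpace ℝ E] [CompleteSpace E]
    {H : Type*} [TopologicalSpace H] (I : ModelWithCorners ℝ E H)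
    (G : Type*) [TopologicalSpace G] [ChartedSpace H G] [Group G]
    [LieGroup I (minSmoothness ℝ 3) G] (k : ℕ)
    (V : ℕ → Submodule ℝ (GroupLieAlgebra I G)) : Prop where
  simplyConnected : SimplyConnectedSpace G
  finiteDimensional : FiniteDimensional ℝ E
  stratification : IsStratification k V

/-- The orthogonal complement, for the bilinear form `B`, of the center of a Lie algebra. -/
def centerPerp {𝔤 : Type*} [LieRing 𝔤] [LieAlgebra ℝ 𝔤] (B : LinearMap.BilinForm ℝ 𝔤) :
    Submodule ℝ 𝔤 :=
  B.orthogonal (LieAlgebra.center ℝ 𝔤).toSubmodule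

/-- The inner product `B` makes the finite-dimensional Lie algebra `𝔤`, with center `Z`, a Lie
algebra of Heisenberg type: `[Z^⊥, Z^⊥] = Z`, and for every `z ∈ Z` with `⟨z, z⟩ = 1` the map
`J_z : Z^⊥ → Z^⊥` determined by `⟨J_z v, w⟩ = ⟨z, [v, w]⟩` for all `w ∈ Z^⊥` is orthogonal. -/
structure IsHeisenbergTypeInner {𝔤 : Type*} [LieRing 𝔤] [LieAlgebra ℝ 𝔤]
    (B : LinearMap.BilinForm ℝ 𝔤) : Prop where
  finiteDimensional : FiniteDimensional ℝ 𝔤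
  symm : ∀ v w, B v w = B w v
  pos : ∀ v, v ≠ 0 → 0 < B v v
  bracket_eq : Submodule.span ℝ {u : 𝔤 | ∃ v ∈ centerPerp B, ∃ w ∈ centerPerp B, ⁅v, w⁆ = u}
    = (LieAlgebra.center ℝ 𝔤).toSubmodule
  orthogonal : ∀ z ∈ LieAlgebra.center ℝ 𝔤, B z z = 1 →
    ∃ J : centerPerp B →ₗ[ℝ] centerPerp B,
      (∀ v w : centerPerp B, B (J v) w = B z ⁅(v : 𝔤), (w : 𝔤)⁆) ∧
      (∀ v w : centerPerp B, B (J v) (J w) = B v w)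

/-! ### The anisotropic Heisenberg group -/

/-- The underlying manifold `ℝ^{2n+1}` of the anisotropic Heisenberg group with parameters
`L_1, …, L_n`. For `q : AnisoHeis L`, the coordinates `x_j` and `x_{j+n}` are
`q.1 (Sum.inl j)` and `q.1 (Sum.inr j)`, and `t` is `q.2`. -/
def AnisoHeis {n : ℕ} (_L : Fin n → ℝ) : Type := (Fin n ⊕ Fin n → ℝ) × ℝ

namespace AnisoHeis

variable {n : ℕ} (L : Fin n → ℝ)

/- The usual smooth structure and Lebesgue measure of `ℝ^{2n+1}`. -/

instance : NormedAddCommGroup (AnisoHeis L) :=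
  inferInstanceAs (NormedAddCommGroup ((Fin n ⊕ Fin n → ℝ) × ℝ))

instance : NormedSpace ℝ (AnisoHeis L) :=
  inferInstanceAs (NormedSpace ℝ ((Fin n ⊕ Fin n → ℝ) × ℝ))

instance : FiniteDimensional ℝ (AnisoHeis L) :=
  inferInstanceAs (FiniteDimensional ℝ ((Fin n ⊕ Fin n → ℝ) × ℝ))

instance : CompleteSpace (AnisoHeis L) :=
  inferInstanceAs (CompleteSpace ((Fin n ⊕ Fin n → ℝ) × ℝ))

instance : MeasureSpace (AnisoHeis L) :=
  inferInstanceAs (MeasureSpace ((Fin n ⊕ Fin n → ℝ) × ℝ))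

instance : BorelSpace (AnisoHeis L) :=
  inferInstanceAs (BorelSpace ((Fin n ⊕ Fin n → ℝ) × ℝ))

/-- The group law
`(x, t) * (y, s) = (x + y, t + s + ∑ j, L_j (x_j y_{j+n} - y_j x_{j+n}))`. -/
instance : Group (AnisoHeis L) where
  mul p q := (p.1 + q.1, p.2 + q.2 +
    ∑ j, L j * (p.1 (.inl j) * q.1 (.inr j) - q.1 (.inl j) * p.1 (.inr j)))
  one := (0, 0)
  inv p := (-p.1, -p.2)
  mul_assoc p q r := by
    refine Prod.ext (add_assoc _ _ _) ?_
    change p.2 + q.2 + _ + r.2 + _ = p.2 + (q.2 + r.2 + _) + _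
    have h : ∀ a b c d e f g : ℝ, d + f = e + g →
        a + b + d + c + f = a + (b + c + e) + g := by intros; linarith
    apply h
    rw [← Finset.sum_add_distrib, ← Finset.sum_add_distrib]
    refine Finset.sum_congr rfl fun j _ => ?_
    change L j * _ + L j * ((p.1 (.inl j) + q.1 (.inl j)) * _ - _ * (p.1 (.inr j) + q.1 (.inr j)))
      = L j * _ + L j * (_ * (q.1 (.inr j) + r.1 (.inr j)) - (q.1 (.inl j) + r.1 (.inl j)) * _)
    ring
  one_mul p := by
    refine Prod.ext (zero_add _) ?_
    change 0 + p.2 + ∑ j, L j * (0 * _ - _ * 0) = p.2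
    simp
  mul_one p := by
    refine Prod.ext (add_zero _) ?_
    change p.2 + 0 + ∑ j, L j * (_ * 0 - 0 * _) = p.2
    simp
  inv_mul_cancel p := by
    refine Prod.ext (neg_add_cancel _) ?_
    change -p.2 + p.2 + ∑ j, L j * (-p.1 (.inl j) * _ - _ * -p.1 (.inr j)) = 0
    have h : ∀ j, L j * (-p.1 (.inl j) * p.1 (.inr j) - p.1 (.inl j) * -p.1 (.inr j)) = 0 := by
      intro j; ring
    simp only [h]
    simp

theorem contDiff_fst : ContDiff ℝ ω (fun q : AnisoHeis L => q.1) :=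
  _root_.contDiff_fst (𝕜 := ℝ) (E := Fin n ⊕ Fin n → ℝ) (F := ℝ)

theorem contDiff_snd : ContDiff ℝ ω (fun q : AnisoHeis L => q.2) :=
  _root_.contDiff_snd (𝕜 := ℝ) (E := Fin n ⊕ Fin n → ℝ) (F := ℝ)

instance : LieGroup 𝓘(ℝ, AnisoHeis L) ω (AnisoHeis L) where
  contMDiff_mul := by
    rw [← modelWithCornersSelf_prod, chartedSpaceSelf_prod, contMDiff_iff_contDiff]
    have h1 : ContDiff ℝ ω (fun p : AnisoHeis L × AnisoHeis L => p.1.1) :=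
      (AnisoHeis.contDiff_fst L).comp _root_.contDiff_fst
    have h2 : ContDiff ℝ ω (fun p : AnisoHeis L × AnisoHeis L => p.2.1) :=
      (AnisoHeis.contDiff_fst L).comp _root_.contDiff_snd
    have h3 : ContDiff ℝ ω (fun p : AnisoHeis L × AnisoHeis L => p.1.2) :=
      (AnisoHeis.contDiff_snd L).comp _root_.contDiff_fst
    have h4 : ContDiff ℝ ω (fun p : AnisoHeis L × AnisoHeis L => p.2.2) :=
      (AnisoHeis.contDiff_snd L).comp _root_.contDiff_snd
    refine ContDiff.prodMk (E := AnisoHeis L × AnisoHeis L) (F := Fin n ⊕ Fin n → ℝ) (G := ℝ)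
      (h1.add h2) ((h3.add h4).add (ContDiff.sum fun j _ => contDiff_const.mul
        (((contDiff_pi.1 h1 _).mul (contDiff_pi.1 h2 _)).sub
          ((contDiff_pi.1 h2 _).mul (contDiff_pi.1 h1 _)))))
  contMDiff_inv := by
    rw [contMDiff_iff_contDiff]
    exact contDiff_neg (𝕜 := ℝ) (F := AnisoHeis L)

instance : LieGroup 𝓘(ℝ, AnisoHeis L) (minSmoothness ℝ 3) (AnisoHeis L) :=
  LieGroup.of_le (n := ω) le_top

/-- The Lie algebra of the group: the tangent space at the identity, with the bracket of
left-invariant vector fields. -/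
abbrev Alg : Type := GroupLieAlgebra 𝓘(ℝ, AnisoHeis L) (AnisoHeis L)

/-- The horizontal vector fields `X_j = ∂_{x_j} - L_j x_{j+n} ∂_t` (index `Sum.inl j`) and
`X_{j+n} = ∂_{x_{j+n}} + L_j x_j ∂_t` (index `Sum.inr j`). -/
def X : Fin n ⊕ Fin n → AnisoHeis L → AnisoHeis L
  | .inl j, q => (Pi.single (.inl j) 1, -L j * q.1 (.inr j))
  | .inr j, q => (Pi.single (.inr j) 1, L j * q.1 (.inl j))

/-- The vertical vector field `T = ∂_t`. -/
def T : AnisoHeis L → AnisoHeis L := fun _ => (0, 1)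

/-- The layers `V_1 = span {X_1, …, X_{2n}}` and `V_2 = span {T}` of the Lie algebra. -/
def layer : ℕ → Submodule ℝ (Alg L)
  | 1 => Submodule.span ℝ (range fun i => (X L i 1 : Alg L))
  | 2 => Submodule.span ℝ {(T L 1 : Alg L)}
  | _ => ⊥

/-- The squared lengths `‖X_j‖² = ‖X_{j+n}‖² = 2 |L_j|`. -/
def normSq : Fin n ⊕ Fin n → ℝ
  | .inl j => 2 * |L j|
  | .inr j => 2 * |L j|

/-- The inner product on the Lie algebra for which the basis `X_1, …, X_{2n}, T` is orthogonal
with `‖X_j‖² = ‖X_{j+n}‖² = 2 |L_j|` and `‖T‖² = 1`. (At the identity, `X_i` and `T` are the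
coordinate vectors.) -/
def metric : LinearMap.BilinForm ℝ (Alg L) :=
  LinearMap.mk₂ ℝ (fun v w : AnisoHeis L => (∑ i, normSq L i * v.1 i * w.1 i) + v.2 * w.2)
    (fun u v w => by
      change (∑ i, normSq L i * (u.1 i + v.1 i) * w.1 i) + (u.2 + v.2) * w.2 = _
      simp only [mul_add, add_mul, Finset.sum_add_distrib]; ring)
    (fun c v w => by
      change (∑ i, normSq L i * (c * v.1 i) * w.1 i) + (c * v.2) * w.2 = c * _
      rw [mul_add, Finset.mul_sum]
      congr 1
      · exact Finset.sum_congr rfl fun i _ => by ring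
      · ring)
    (fun u v w => by
      change (∑ i, normSq L i * u.1 i * (v.1 i + w.1 i)) + u.2 * (v.2 + w.2) = _
      simp only [mul_add, Finset.sum_add_distrib]; ring)
    (fun c v w => by
      change (∑ i, normSq L i * v.1 i * (c * w.1 i)) + v.2 * (c * w.2) = c * _
      rw [mul_add, Finset.mul_sum]
      congr 1
      · exact Finset.sum_congr rfl fun i _ => by ring
      · ring)

/-! ### Horizontal calculus -/

/-- The derivative `X_i f`. -/
def XDeriv (i : Fin n ⊕ Fin n) (f : AnisoHeis L → ℝ) (q : AnisoHeis L) : ℝ :=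
  fderiv ℝ f q (X L i q)

/-- The horizontal gradient of `f` is the horizontal field `∇₀ f` with `⟨∇₀ f, X_i⟩ = X_i f`, that
is `∇₀ f = ∑ i, (X_i f / ‖X_i‖²) X_i`. If `d = (X_i f)_i` and `e = (X_i g)_i`, then
`gradInner L d e = ⟨∇₀ f, ∇₀ g⟩`. -/
def gradInner (d e : Fin n ⊕ Fin n → ℝ) : ℝ := ∑ i, d i * e i / normSq L i

/-- The length `‖∇₀ f‖ = (∑ i, (X_i f)² / ‖X_i‖²)^{1/2}`, for `d = (X_i f)_i`. -/
def gradNorm (d : Fin n ⊕ Fin n → ℝ) : ℝ := Real.sqrt (gradInner L d d)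

/-- The horizontal `∞`-Laplacian
`Δ_∞ f = ∑_{i,j} (1 / (‖X_i‖² ‖X_j‖²)) (X_i X_j f) (X_i f) (X_j f)`. -/
def infLaplacian (f : AnisoHeis L → ℝ) (q : AnisoHeis L) : ℝ :=
  ∑ i, ∑ j, 1 / (normSq L i * normSq L j) *
    XDeriv L i (XDeriv L j f) q * XDeriv L i f q * XDeriv L j f q

/-- Smooth compactly supported test functions on `Ω`. -/
def IsTestFun (Ω : Set (AnisoHeis L)) (φ : AnisoHeis L → ℝ) : Prop :=
  ContDiff ℝ ∞ φ ∧ HasCompactSupport φ ∧ tsupport φ ⊆ Ω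

/-- `f ∈ L^p_loc(Ω)`. -/
def IsLpLoc (p : ℝ) (Ω : Set (AnisoHeis L)) (f : AnisoHeis L → ℝ) : Prop :=
  ∀ K ⊆ Ω, IsCompact K → MemLp f (ENNReal.ofReal p) (volume.restrict K)

/-- `u` belongs to the horizontal Sobolev space `W^{1,p}_loc(Ω)` and its weak derivatives
along the fields `X_i` are `d i`. (The fields `X_i` are divergence free.) -/
structure HasWeakHorizontalDeriv (p : ℝ) (Ω : Set (AnisoHeis L)) (u : AnisoHeis L → ℝ)
    (d : Fin n ⊕ Fin n → AnisoHeis L → ℝ) : Prop where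
  isLpLoc : IsLpLoc L p Ω u
  isLpLoc_deriv : ∀ i, IsLpLoc L p Ω (d i)
  integral_eq : ∀ i φ, IsTestFun L Ω φ → ∫ q, u q * XDeriv L i φ q = -∫ q, d i q * φ q

/-- `u` is a fundamental solution of the horizontal `p`-Laplace equation, where
`Δ_p u = div (‖∇₀ u‖^{p-2} ∇₀ u)`, with singularity at `a`: `u ∈ W^{1,p}_loc(G ∖ {a})`,
`‖∇₀ u‖^{p-1} ∈ L¹_loc(G)`, and `Δ_p u = δ_a` on `G` in the sense of distributions, i.e.
`∫ ‖∇₀ u‖^{p-2} ⟨∇₀ u, ∇₀ φ⟩ = - φ(a)` for all test functions `φ` on `G`. -/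
def IsFundamentalSolution (p : ℝ) (a : AnisoHeis L) (u : AnisoHeis L → ℝ) : Prop :=
  ∃ d : Fin n ⊕ Fin n → AnisoHeis L → ℝ,
    HasWeakHorizontalDeriv L p {a}ᶜ u d ∧
    LocallyIntegrable (fun q => gradNorm L (fun i => d i q) ^ (p - 1)) ∧
    ∀ φ, IsTestFun L univ φ →
      ∫ q, gradNorm L (fun i => d i q) ^ (p - 2) *
        gradInner L (fun i => d i q) (fun i => XDeriv L i φ q) = -φ a

/-- The homogeneous dimension `Q = dim V_1 + 2 dim V_2 = 2 n + 2`. -/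
def homDim (_L : Fin n → ℝ) : ℝ := 2 * n + 2

/-- The dilations `(x, t) ↦ (r x, r² t)`. -/
def dil (r : ℝ) (q : AnisoHeis L) : AnisoHeis L := (r • q.1, r ^ 2 * q.2)

/-- Folland's fundamental solution of the (positive) sub-Laplacian `-Δ_2`: the
function that is smooth and positive on `G ∖ {e}`, homogeneous of degree `2 - Q`, and satisfies
`-Δ_2 u = δ_e`. -/
structure IsFollandSolution (u : AnisoHeis L → ℝ) : Prop where
  contDiffOn : ContDiffOn ℝ ∞ u {1}ᶜ
  pos : ∀ q ≠ 1, 0 < u q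
  homogeneous : ∀ r > 0, ∀ q ≠ 1, u (dil L r q) = r ^ (2 - homDim L) * u q
  fundamental : IsFundamentalSolution L 2 1 (fun q => -u q)

/-- The group, with the given metric, is polarizable: the homogeneous norm
`N = u^{1/(2-Q)}` associated to Folland's solution `u` satisfies `Δ_∞ N = 0` on `G ∖ {e}`. -/
def IsPolarizable : Prop :=
  ∃ u, IsFollandSolution L u ∧
    ∀ q ≠ 1, infLaplacian L (fun y => u y ^ (1 / (2 - homDim L))) q = 0

/-! ### The gauge and the function `Γ_p` -/

/-- `ρ(x, t) = ((∑_j 2 |L_j| x_j² + ∑_j 2 |L_j| x_{j+n}²)² + 16 t²)^{1/4}`. -/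
def rho (q : AnisoHeis L) : ℝ :=
  ((∑ j, 2 * |L j| * q.1 (.inl j) ^ 2 + ∑ j, 2 * |L j| * q.1 (.inr j) ^ 2) ^ 2
    + 16 * q.2 ^ 2) ^ (1 / 4 : ℝ)

/-- `ω_p = ∫_{ρ < 1} ‖∇₀ ρ‖^p`. -/
def omegaP (p : ℝ) : ℝ :=
  ∫ q in {q | rho L q < 1}, gradNorm L (fun i => XDeriv L i (rho L) q) ^ p

open Classical in
/-- `C_p = ((p-1)/(p-Q)) (Q ω_p)^{-1/(p-1)}` if `p ≠ Q`, and `C_p = (Q ω_p)^{-1/(p-1)}`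
if `p = Q`. -/
def constP (p : ℝ) : ℝ :=
  if p = homDim L then (homDim L * omegaP L p) ^ (-1 / (p - 1))
  else (p - 1) / (p - homDim L) * (homDim L * omegaP L p) ^ (-1 / (p - 1))

open Classical in
/-- `Γ_p = C_p ρ^{(p-Q)/(p-1)}` if `p ≠ Q`, and `Γ_p = C_p log ρ` if `p = Q`. -/
def GammaP (p : ℝ) (q : AnisoHeis L) : ℝ :=
  if p = homDim L then constP L p * Real.log (rho L q)
  else constP L p * rho L q ^ ((p - homDim L) / (p - 1))

end AnisoHeis

end

noncomputable section

namespace AnisoHeis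

variable {n : ℕ} (L : Fin n → ℝ)

/-! Everything rests on two vector fields: the generator `Z = ∑ x_i ∂_{x_i} + 2 t ∂_t` of the
dilations (`dilGen`) and a rotation `R` of each plane `(x_j, x_{j+n})`, oriented by the sign of
`L_j` (`rotGen`). The bracket is twice the alternating form of the group law. The weights `2|L_j|`
are exactly those for which `R` represents this bracket against `T`; being an isometry, `R` gives
the Heisenberg type condition.

Let `s = ∑ w_i x_i²`, so that `ρ⁴ = s² + 16 t²`. The key identity (`hgrad_rho`) is `∇₀ρ = (s/ρ³) Z +
(4t/ρ³) R`. Since `Zρ = ρ` and `Rρ = 0`, it gives `‖∇₀ρ‖² = s/ρ²`. This function is invariant under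
dilations and rotations, so `∇₀ρ` annihilates it; and `Δ_∞ρ` is half the derivative of `‖∇₀ρ‖²`
along `∇₀ρ`, hence zero.

For `Γ_p`, write `σ = ‖∇₀ρ‖`. The constant `C_p` is chosen so that the flux `‖∇₀Γ_p‖^{p-2} ∇₀Γ_p`
equals `(Qω_p)⁻¹ (ρ^{-Q} σ^p Z + 4t ρ^{-Q-2} σ^{p-2} R)` (`flux_eq`). Tested against `φ`, both terms
are `O(ρ^{1-Q})`, which is locally integrable. The `R` term vanishes by averaging over the orbits of
the measure-preserving rotations. In polar coordinates (`integral_polar`) the `Z` term becomes the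
integral of `d/dr φ` along each dilation ray, which is `-φ(e)`, times the total weight `Qω_p`.

Finally `-Γ_2` is a positive multiple of `ρ^{2-Q}`, so it serves as Folland's solution and its norm
`N` is a multiple of `ρ`. -/

theorem ext_iff' {p q : AnisoHeis L} : p = q ↔ (∀ i, p.1 i = q.1 i) ∧ p.2 = q.2 :=
  ⟨fun h => by subst h; exact ⟨fun _ => rfl, rfl⟩, fun h => Prod.ext (funext h.1) h.2⟩

/-! ### Coordinates and the alternating form of the group law -/

/-- The horizontal coordinates as a continuous linear map. -/
def fstL : AnisoHeis L →L[ℝ] (Fin n ⊕ Fin n → ℝ) :=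
  ContinuousLinearMap.fst ℝ (Fin n ⊕ Fin n → ℝ) ℝ

/-- The vertical coordinate as a continuous linear map. -/
def sndL : AnisoHeis L →L[ℝ] ℝ := ContinuousLinearMap.snd ℝ (Fin n ⊕ Fin n → ℝ) ℝ

/-- The coordinate `x_i` as a continuous linear map. -/
def coord (i : Fin n ⊕ Fin n) : AnisoHeis L →L[ℝ] ℝ :=
  (ContinuousLinearMap.proj (R := ℝ) (φ := fun _ : Fin n ⊕ Fin n => ℝ) i).comp (fstL L)

@[simp] theorem sndL_apply (q : AnisoHeis L) : sndL L q = q.2 := rfl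
@[simp] theorem coord_apply (i : Fin n ⊕ Fin n) (q : AnisoHeis L) : coord L i q = q.1 i := rfl

@[simp] theorem add_fst (p q : AnisoHeis L) : (p + q).1 = p.1 + q.1 := rfl
@[simp] theorem add_snd (p q : AnisoHeis L) : (p + q).2 = p.2 + q.2 := rfl
@[simp] theorem sub_fst (p q : AnisoHeis L) : (p - q).1 = p.1 - q.1 := rfl
@[simp] theorem sub_snd (p q : AnisoHeis L) : (p - q).2 = p.2 - q.2 := rfl
@[simp] theorem neg_fst (q : AnisoHeis L) : (-q).1 = -q.1 := rfl
@[simp] theorem neg_snd (q : AnisoHeis L) : (-q).2 = -q.2 := rfl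
@[simp] theorem smul_fst (c : ℝ) (q : AnisoHeis L) : (c • q).1 = c • q.1 := rfl
@[simp] theorem smul_snd (c : ℝ) (q : AnisoHeis L) : (c • q).2 = c * q.2 := rfl
@[simp] theorem zero_fst : (0 : AnisoHeis L).1 = 0 := rfl
@[simp] theorem zero_snd : (0 : AnisoHeis L).2 = 0 := rfl

theorem one_eq_zero : (1 : AnisoHeis L) = 0 := rfl

/-- The vertical direction `c ∂_t` as a continuous linear function of `c`. -/
def vert : ℝ →L[ℝ] AnisoHeis L := ContinuousLinearMap.inr ℝ (Fin n ⊕ Fin n → ℝ) ℝ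

@[simp] theorem vert_fst (c : ℝ) : (vert L c).1 = 0 := rfl
@[simp] theorem vert_snd (c : ℝ) : (vert L c).2 = c := rfl

/-- The form `(p, q) ↦ ∑ j, L_j (x_j(p) x_{j+n}(q) - x_j(q) x_{j+n}(p))`. -/
def symp : AnisoHeis L →L[ℝ] AnisoHeis L →L[ℝ] ℝ :=
  ∑ j, L j • ((coord L (.inl j)).smulRight (coord L (.inr j)) -
    (coord L (.inr j)).smulRight (coord L (.inl j)))

theorem symp_apply (p q : AnisoHeis L) :
    symp L p q = ∑ j, L j * (p.1 (.inl j) * q.1 (.inr j) - q.1 (.inl j) * p.1 (.inr j)) := by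
  simp only [symp, sum_apply, smul_apply,
    sub_apply, ContinuousLinearMap.smulRight_apply, coord_apply, smul_eq_mul]
  exact Finset.sum_congr rfl fun j _ => by ring

theorem symp_swap (v w : AnisoHeis L) : symp L w v = - symp L v w := by
  rw [symp_apply, symp_apply, ← Finset.sum_neg_distrib]
  exact Finset.sum_congr rfl fun j _ => by ring

theorem mul_eq (p q : AnisoHeis L) : p * q = p + (q + vert L (symp L p q)) := by
  refine Prod.ext (show p.1 + q.1 = p.1 + (q.1 + 0) by rw [add_zero]) ?_
  change p.2 + q.2 + _ = p.2 + (q.2 + symp L p q)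
  rw [symp_apply, add_assoc]

/-! ### Left-invariant fields and the Lie bracket -/

theorem hasFDerivAt_mul_left (p q : AnisoHeis L) :
    HasFDerivAt (fun q => p * q)
      (ContinuousLinearMap.id ℝ (AnisoHeis L) + (vert L).comp (symp L p)) q := by
  have h := ((ContinuousLinearMap.id ℝ (AnisoHeis L) +
    (vert L).comp (symp L p)).hasFDerivAt (x := q)).const_add p
  refine h.congr_of_eventuallyEq (Filter.Eventually.of_forall fun q => ?_)
  exact mul_eq L p q

theorem mulInvariantVectorField_apply (v : AnisoHeis L) (q : AnisoHeis L) :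
    mulInvariantVectorField (I := 𝓘(ℝ, AnisoHeis L)) (v : Alg L) q
      = (v + vert L (symp L q v) : AnisoHeis L) := by
  change mfderiv 𝓘(ℝ, AnisoHeis L) 𝓘(ℝ, AnisoHeis L) (fun p => q * p) 1 v = _
  rw [mfderiv_eq_fderiv, (hasFDerivAt_mul_left L q 1).fderiv]
  rfl

/-- The invariant field of `v` is affine in the base point, with derivative `symp · v` in the
vertical direction. At the identity `DW·V - DV·W` is therefore `symp v w - symp w v`, and
antisymmetry doubles it. -/
theorem bracket_apply (v w : AnisoHeis L) :
    Bracket.bracket (L := Alg L) (M := Alg L) v w = (vert L (2 * symp L v w) : AnisoHeis L) := by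
  have hf : ∀ v : AnisoHeis L, (mulInvariantVectorField (I := 𝓘(ℝ, AnisoHeis L)) (v : Alg L))
      = (fun q : AnisoHeis L => (v + vert L (symp L q v) : AnisoHeis L)) := fun v =>
    funext fun q => mulInvariantVectorField_apply L v q
  have hd : ∀ v q : AnisoHeis L, HasFDerivAt
      (fun q : AnisoHeis L => (v + vert L (symp L q v) : AnisoHeis L))
        ((vert L).comp ((symp L).flip v)) q := fun v q =>
    ((vert L).comp ((symp L).flip v)).hasFDerivAt.const_add v
  -- On a vector space the manifold bracket is the classical `DW·V - DV·W`.
  have hb : ∀ V W : AnisoHeis L → AnisoHeis L, ∀ q,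
      (VectorField.mlieBracket 𝓘(ℝ, AnisoHeis L) V W q : AnisoHeis L)
        = fderiv ℝ W q (V q) - fderiv ℝ V q (W q) := fun V W q =>
    (congrFun VectorField.mlieBracketWithin_univ.symm q).trans
      ((congrFun VectorField.mlieBracketWithin_eq_lieBracketWithin q).trans
        (congrFun VectorField.lieBracketWithin_univ q))
  change VectorField.mlieBracket 𝓘(ℝ, AnisoHeis L)
    (mulInvariantVectorField (I := 𝓘(ℝ, AnisoHeis L)) (v : Alg L))
    (mulInvariantVectorField (I := 𝓘(ℝ, AnisoHeis L)) (w : Alg L)) 1 = _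
  rw [hf, hf]
  refine (hb _ _ 1).trans ?_
  rw [(hd v 1).fderiv, (hd w 1).fderiv]
  simp only [one_eq_zero, map_zero, zero_apply, add_zero, ContinuousLinearMap.comp_apply,
    ContinuousLinearMap.flip_apply]
  rw [symp_swap L v w, ← map_sub]
  congr 1
  ring

@[simp] theorem X_fst (i : Fin n ⊕ Fin n) (q : AnisoHeis L) : (X L i q).1 = Pi.single i 1 := by
  rcases i with i | i <;> rfl

theorem X_snd_inl (j : Fin n) (q : AnisoHeis L) : (X L (.inl j) q).2 = -L j * q.1 (.inr j) := rfl

theorem X_snd_inr (j : Fin n) (q : AnisoHeis L) : (X L (.inr j) q).2 = L j * q.1 (.inl j) := rfl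

@[simp] theorem T_fst (q : AnisoHeis L) : (T L q).1 = 0 := rfl

@[simp] theorem T_snd (q : AnisoHeis L) : (T L q).2 = 1 := rfl

/-- Besides left invariance, this form displays each field as a constant vector plus a vertical one
whose coefficient is linear and independent of `t`; smoothness and vanishing divergence are read off
from it. -/
theorem X_eq (i : Fin n ⊕ Fin n) (q : AnisoHeis L) :
    X L i q = X L i 1 + vert L (symp L q (X L i 1)) := by
  rw [ext_iff']
  rcases i with i | i
  · exact ⟨by simp, by simp [X_snd_inl, symp_apply, one_eq_zero, Pi.single_apply]⟩
  · exact ⟨by simp, by simp [X_snd_inr, symp_apply, one_eq_zero, Pi.single_apply]⟩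

theorem mulInvariantVectorField_X (i : Fin n ⊕ Fin n) (q : AnisoHeis L) :
    mulInvariantVectorField (I := 𝓘(ℝ, AnisoHeis L)) (X L i 1 : Alg L) q = X L i q := by
  rw [X_eq L i q]
  exact mulInvariantVectorField_apply L (X L i 1) q

theorem mulInvariantVectorField_T (q : AnisoHeis L) :
    mulInvariantVectorField (I := 𝓘(ℝ, AnisoHeis L)) (T L 1 : Alg L) q = T L q := by
  refine (mulInvariantVectorField_apply L (T L 1) q).trans ?_
  exact (ext_iff' L).2 ⟨by simp [T_fst], by simp [symp_apply, T_fst, T_snd]⟩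

theorem eq_sum_X (v : AnisoHeis L) (hv : v.2 = 0) : v = ∑ i, v.1 i • X L i 1 := by
  have h1 : (∑ i, v.1 i • X L i 1).1 = ∑ i, v.1 i • (X L i 1).1 := map_sum (fstL L) _ _
  have h2 : (∑ i, v.1 i • X L i 1).2 = ∑ i, v.1 i * (X L i 1).2 := map_sum (sndL L) _ _
  refine (ext_iff' L).2 ⟨fun k => ?_, ?_⟩
  · rw [h1]; simp [Pi.single_apply]
  · rw [h2, hv]; simp [X_snd_inl, X_snd_inr, one_eq_zero]

theorem X_one_snd (i : Fin n ⊕ Fin n) : (X L i 1).2 = 0 := by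
  rcases i with i | i <;> simp [X_snd_inl, X_snd_inr, one_eq_zero]

/-! ### The stratification -/

/-- The Lie algebra, as a vector space, is the underlying vector space of the group. -/
def vec : Alg L ≃ₗ[ℝ] AnisoHeis L where
  toFun v := v
  invFun v := v
  map_add' _ _ := rfl
  map_smul' _ _ := rfl
  left_inv _ := rfl
  right_inv _ := rfl

theorem vec_bracket (v w : Alg L) : vec L ⁅v, w⁆ = vert L (2 * symp L (vec L v) (vec L w)) :=
  bracket_apply L v w

theorem vec_ext {v w : Alg L} (h1 : ∀ i, (vec L v).1 i = (vec L w).1 i)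
    (h2 : (vec L v).2 = (vec L w).2) : v = w :=
  (vec L).injective ((ext_iff' L).2 ⟨h1, h2⟩)

theorem symp_eq_zero_of_fst_eq_zero {v w : AnisoHeis L} (hw : w.1 = 0) : symp L v w = 0 := by
  rw [symp_apply]
  exact Finset.sum_eq_zero fun j _ => by rw [hw]; simp

theorem layer_one_eq :
    layer L 1 = Submodule.span ℝ (range fun i => (vec L).symm (X L i 1)) := rfl

theorem layer_two_eq : layer L 2 = Submodule.span ℝ {(vec L).symm (T L 1)} := rfl

theorem mem_layer_one (v : Alg L) : v ∈ layer L 1 ↔ (vec L v).2 = 0 := by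
  constructor
  · intro h
    have : layer L 1 ≤ LinearMap.ker ((sndL L).toLinearMap ∘ₗ (vec L).toLinearMap) := by
      rw [layer_one_eq, Submodule.span_le]
      rintro _ ⟨i, rfl⟩
      exact X_one_snd L i
    exact this h
  · intro h
    have : v = ∑ i, (vec L v).1 i • (vec L).symm (X L i 1) := by
      apply (vec L).injective
      simp only [map_sum, map_smul, LinearEquiv.apply_symm_apply]
      exact eq_sum_X L _ h
    rw [this]
    exact Submodule.sum_mem _ fun i _ => Submodule.smul_mem _ _
      (Submodule.subset_span ⟨i, rfl⟩)

theorem mem_layer_two (v : Alg L) : v ∈ layer L 2 ↔ (vec L v).1 = 0 := by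
  constructor
  · intro h
    have : layer L 2 ≤ LinearMap.ker ((fstL L).toLinearMap ∘ₗ (vec L).toLinearMap) := by
      rw [layer_two_eq, Submodule.span_le]
      rintro _ rfl
      exact T_fst L 1
    exact this h
  · intro h
    rw [layer_two_eq]
    exact Submodule.mem_span_singleton.2
      ⟨(vec L v).2, vec_ext L (fun i => by simp [h]) (by simp)⟩

theorem layer_eq_bot {j : ℕ} (h1 : j ≠ 1) (h2 : j ≠ 2) : layer L j = ⊥ := by
  match j, h1, h2 with
  | 0, _, _ => rfl
  | (_ + 3), _, _ => rfl

variable {L}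

theorem span_bracket_layer_one (hn : 1 ≤ n) (hL : ∀ j, L j ≠ 0) :
    Submodule.span ℝ {u : Alg L | ∃ x ∈ layer L 1, ∃ y ∈ layer L 1, ⁅x, y⁆ = u} = layer L 2 := by
  apply le_antisymm
  · rw [Submodule.span_le]
    rintro _ ⟨x, -, y, -, rfl⟩
    refine (mem_layer_two L _).2 ?_
    rw [vec_bracket, vert_fst]
  · intro v hv
    rw [mem_layer_two] at hv
    -- Since `[X_j, X_{j+n}] = 2 L_j T`, a single index with `L_j ≠ 0` already produces every
    -- multiple of `T`.
    let j : Fin n := ⟨0, hn⟩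
    refine Submodule.subset_span
      ⟨(vec L).symm (((vec L v).2 / (2 * L j)) • X L (.inl j) 1),
        (mem_layer_one L _).2 (by simp [X_one_snd]), (vec L).symm (X L (.inr j) 1),
        (mem_layer_one L _).2 (by simp [X_one_snd]), vec_ext L (fun i => ?_) ?_⟩
    · rw [vec_bracket, vert_fst, hv]
    · have := hL j
      rw [vec_bracket, vert_snd, symp_apply]
      simp [Pi.single_apply]
      field_simp

theorem isStratification (hn : 1 ≤ n) (hL : ∀ j, L j ≠ 0) : IsStratification 2 (layer L) where
  isInternal := by
    rw [DirectSum.isInternal_submodule_iff_isCompl (i := (0 : Fin 2)) (j := 1) _ (by decide)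
      (by ext i; fin_cases i <;> simp)]
    refine ⟨Submodule.disjoint_def.2 fun v h1 h2 => ?_, codisjoint_iff.2 (eq_top_iff.2 ?_)⟩
    · have h1 := (mem_layer_one L v).1 h1
      have h2 := (mem_layer_two L v).1 h2
      exact vec_ext L (fun i => by rw [h2, map_zero]; rfl) h1
    · intro v _
      have hv : v = (v - (vec L).symm (vert L (vec L v).2)) + (vec L).symm (vert L (vec L v).2) :=
        (sub_add_cancel _ _).symm
      rw [hv]
      refine Submodule.add_mem_sup ((mem_layer_one L _).2 ?_) ((mem_layer_two L _).2 ?_) <;> simp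
  bracket_eq := by
    intro j hj
    rcases Nat.lt_or_ge j 2 with h | h
    · obtain rfl : j = 1 := by omega
      exact span_bracket_layer_one hn hL
    · rw [layer_eq_bot L (show j + 1 ≠ 1 by omega) (show j + 1 ≠ 2 by omega), Submodule.span_eq_bot]
      rintro _ ⟨x, -, y, hy, rfl⟩
      -- From the second layer on, elements are vertical, and the alternating form does not see
      -- vertical components.
      have hy1 : (vec L y).1 = 0 := by
        rcases eq_or_ne j 2 with rfl | h2
        · exact (mem_layer_two L _).1 hy
        · rw [layer_eq_bot L (by omega) h2] at hy
          rw [(Submodule.mem_bot ℝ).1 hy]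
          rfl
      apply (vec L).injective
      rw [vec_bracket, symp_eq_zero_of_fst_eq_zero L hy1, mul_zero, map_zero, map_zero]
  eq_bot j hj := layer_eq_bot L (by omega) (by omega)

theorem isCarnotGroup (hn : 1 ≤ n) (hL : ∀ j, L j ≠ 0) :
    IsCarnotGroup 𝓘(ℝ, AnisoHeis L) (AnisoHeis L) 2 (layer L) where
  simplyConnected := inferInstance
  finiteDimensional := inferInstance
  stratification := isStratification hn hL

/-! ### The center and the Heisenberg type condition -/

theorem center_eq (hL : ∀ j, L j ≠ 0) :
    (LieAlgebra.center ℝ (Alg L)).toSubmodule = layer L 2 := by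
  ext v
  refine Iff.trans ?_ (mem_layer_two L v).symm
  rw [LieSubmodule.mem_toSubmodule, LieModule.mem_maxTrivSubmodule]
  constructor
  · intro h
    have hs : ∀ w : AnisoHeis L, symp L w (vec L v) = 0 := fun w => by
      have := congrArg (fun u => (vec L u).2) (h ((vec L).symm w))
      simpa [vec_bracket] using this
    funext i
    rcases i with j | j
    -- The form is nondegenerate on horizontal vectors: pairing with `X_{j+n}` isolates `L_j x_j`,
    -- pairing with `X_j` isolates `L_j x_{j+n}`.
    · have := hs (X L (.inr j) 1)
      simpa [symp_apply, Pi.single_apply, hL j] using this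
    · have := hs (X L (.inl j) 1)
      simpa [symp_apply, Pi.single_apply, hL j] using this
  · intro h w
    apply (vec L).injective
    rw [vec_bracket, symp_eq_zero_of_fst_eq_zero L h, mul_zero, map_zero, map_zero]

theorem metric_apply (v w : Alg L) : metric L v w =
    (∑ i, normSq L i * (vec L v).1 i * (vec L w).1 i) + (vec L v).2 * (vec L w).2 := rfl

theorem normSq_pos (hL : ∀ j, L j ≠ 0) (i : Fin n ⊕ Fin n) : 0 < normSq L i := by
  rcases i with j | j <;> exact mul_pos two_pos (abs_pos.2 (hL j))

theorem centerPerp_eq (hL : ∀ j, L j ≠ 0) : centerPerp (metric L) = layer L 1 := by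
  ext v
  refine Iff.trans ?_ (mem_layer_one L v).symm
  rw [centerPerp, LinearMap.BilinForm.mem_orthogonal_iff, center_eq hL]
  constructor
  · intro h
    have := h ((vec L).symm (T L 1)) ((mem_layer_two L _).2 rfl)
    simpa [metric_apply] using this
  · intro h w hw
    have hw := (mem_layer_two L w).1 hw
    refine (metric_apply w v).trans ?_
    rw [hw, h]
    simp

/-- The rotation `x_j ↦ -sgn(L_j) x_{j+n}`, `x_{j+n} ↦ sgn(L_j) x_j`. -/
def rotGen : AnisoHeis L →L[ℝ] AnisoHeis L :=
  (ContinuousLinearMap.pi (Sum.elim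
    (fun j => (-SignType.sign (L j) : ℝ) • coord L (.inr j))
    (fun j => (SignType.sign (L j) : ℝ) • coord L (.inl j)))).prod 0

@[simp] theorem rotGen_inl (q : AnisoHeis L) (j : Fin n) :
    (rotGen q).1 (.inl j) = -SignType.sign (L j) * q.1 (.inr j) := rfl

@[simp] theorem rotGen_inr (q : AnisoHeis L) (j : Fin n) :
    (rotGen q).1 (.inr j) = SignType.sign (L j) * q.1 (.inl j) := rfl

@[simp] theorem rotGen_snd (q : AnisoHeis L) : (rotGen q).2 = 0 := rfl

/-- This identifies `rotGen` with `J_T`: the weight `2|L_j|` times `sgn L_j` is `2 L_j`, the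
coefficient in the bracket. -/
theorem sum_rotGen_mul (v w : AnisoHeis L) :
    ∑ i, normSq L i * (rotGen v).1 i * w.1 i = 2 * symp L v w := by
  rw [symp_apply, Fintype.sum_sum_type, ← Finset.sum_add_distrib, Finset.mul_sum]
  refine Finset.sum_congr rfl fun j _ => ?_
  simp only [normSq, rotGen_inl, rotGen_inr]
  have := sign_mul_abs (L j)
  linear_combination (2 * (v.1 (.inl j) * w.1 (.inr j) - v.1 (.inr j) * w.1 (.inl j))) * this

theorem sign_mul_sign (hL : ∀ j, L j ≠ 0) (j : Fin n) :
    (SignType.sign (L j) : ℝ) * SignType.sign (L j) = 1 := by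
  rcases lt_or_gt_of_ne (hL j) with h | h <;> simp [h]

/-- `x_j` and `x_{j+n}` carry the same weight, so exchanging them up to a sign is an isometry. -/
theorem sum_rotGen_mul_rotGen (hL : ∀ j, L j ≠ 0) (v w : AnisoHeis L) :
    ∑ i, normSq L i * (rotGen v).1 i * (rotGen w).1 i = ∑ i, normSq L i * v.1 i * w.1 i := by
  rw [Fintype.sum_sum_type, Fintype.sum_sum_type, ← Finset.sum_add_distrib,
    ← Finset.sum_add_distrib]
  refine Finset.sum_congr rfl fun j _ => ?_
  simp only [normSq, rotGen_inl, rotGen_inr]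
  linear_combination (2 * |L j| * (v.1 (.inl j) * w.1 (.inl j) + v.1 (.inr j) * w.1 (.inr j))) *
    sign_mul_sign hL j

theorem isHeisenbergTypeInner (hn : 1 ≤ n) (hL : ∀ j, L j ≠ 0) :
    IsHeisenbergTypeInner (metric L) where
  finiteDimensional := inferInstanceAs (FiniteDimensional ℝ (AnisoHeis L))
  symm v w := by
    rw [metric_apply, metric_apply]
    congr 1
    · exact Finset.sum_congr rfl fun i _ => by ring
    · ring
  pos v hv := by
    rw [metric_apply]
    have hnn : ∀ i ∈ Finset.univ, 0 ≤ normSq L i * (vec L v).1 i * (vec L v).1 i := fun i _ => by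
      rw [mul_assoc]; exact mul_nonneg (normSq_pos hL i).le (mul_self_nonneg _)
    by_contra! hle
    have h1 := Finset.sum_nonneg hnn
    have h2 := mul_self_nonneg (vec L v).2
    refine hv (vec_ext L (fun i => ?_) (mul_self_eq_zero.1 (le_antisymm (by linarith) h2)))
    have := (Finset.sum_eq_zero_iff_of_nonneg hnn).1 (le_antisymm (by linarith) h1) i
      (Finset.mem_univ i)
    rw [mul_assoc] at this
    exact mul_self_eq_zero.1 ((mul_eq_zero.1 this).resolve_left (normSq_pos hL i).ne')
  bracket_eq := by
    rw [centerPerp_eq hL, center_eq hL]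
    exact span_bracket_layer_one hn hL
  orthogonal z hz hz1 := by
    have hz' : (vec L z).1 = 0 := by
      rw [← LieSubmodule.mem_toSubmodule, center_eq hL] at hz
      exact (mem_layer_two L z).1 hz
    have hcc : (vec L z).2 * (vec L z).2 = 1 := by
      rw [metric_apply, hz'] at hz1
      simpa using hz1
    have hperp : ∀ v : Alg L, v ∈ centerPerp (metric L) ↔ (vec L v).2 = 0 :=
      fun v => by rw [centerPerp_eq hL]; exact mem_layer_one L v
    -- A central `z` is `c T`, so `J_z = c J_T`; the normalisation gives `c² = 1`, which keeps `J_z`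
    -- orthogonal.
    let A : Alg L →ₗ[ℝ] Alg L := (vec L).symm.toLinearMap ∘ₗ
      ((vec L z).2 • (rotGen (L := L)).toLinearMap) ∘ₗ (vec L).toLinearMap
    have hA : ∀ v, vec L (A v) = (vec L z).2 • rotGen (vec L v) := fun v => rfl
    have hA2 : ∀ v, (vec L (A v)).2 = 0 := fun v => mul_zero _
    refine ⟨(A.domRestrict _).codRestrict _ fun v => (hperp _).2 (hA2 v),
      fun v w => ?_, fun v w => ?_⟩
    · change metric L (A v) w = _
      rw [metric_apply, metric_apply, hA2, vec_bracket, vert_fst, vert_snd,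
        ← sum_rotGen_mul, Finset.mul_sum, hA]
      simp only [smul_fst, Pi.smul_apply, smul_eq_mul, Pi.zero_apply, mul_zero, zero_mul,
        Finset.sum_const_zero, zero_add, add_zero]
      exact Finset.sum_congr rfl fun i _ => by ring
    · change metric L (A v) (A w) = metric L v w
      rw [metric_apply, metric_apply, hA2, hA, hA, (hperp _).1 v.2,
        ← sum_rotGen_mul_rotGen hL (vec L v)]
      simp only [smul_fst, Pi.smul_apply, smul_eq_mul, zero_mul, add_zero]
      refine Finset.sum_congr rfl fun i _ => ?_
      linear_combination (normSq L i * (rotGen (vec L v)).1 i * (rotGen (vec L w)).1 i) * hcc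

/-! ### The gauge and its differential -/

variable (L) in
/-- The horizontal square `s(x, t) = ∑ i, ‖X_i‖² x_i²`. -/
def hsq (q : AnisoHeis L) : ℝ := ∑ i, normSq L i * q.1 i ^ 2

variable (L) in
/-- The fourth power `s² + 16 t²` of the gauge. -/
def gauge4 (q : AnisoHeis L) : ℝ := hsq L q ^ 2 + 16 * q.2 ^ 2

theorem normSq_nonneg (i : Fin n ⊕ Fin n) : 0 ≤ normSq L i := by
  rcases i with j | j <;> exact mul_nonneg two_pos.le (abs_nonneg _)

theorem hsq_nonneg (q : AnisoHeis L) : 0 ≤ hsq L q :=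
  Finset.sum_nonneg fun i _ => mul_nonneg (normSq_nonneg i) (sq_nonneg _)

theorem gauge4_nonneg (q : AnisoHeis L) : 0 ≤ gauge4 L q := by unfold gauge4; positivity

theorem rho_eq (q : AnisoHeis L) : rho L q = gauge4 L q ^ (1 / 4 : ℝ) := by
  rw [gauge4, hsq, Fintype.sum_sum_type]
  rfl

theorem rho_nonneg (q : AnisoHeis L) : 0 ≤ rho L q := by
  rw [rho_eq]; exact Real.rpow_nonneg (gauge4_nonneg q) _

theorem rho_pow_four (q : AnisoHeis L) : rho L q ^ 4 = gauge4 L q := by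
  rw [rho_eq, ← Real.rpow_natCast, ← Real.rpow_mul (gauge4_nonneg q)]
  norm_num

theorem hsq_eq_zero (hL : ∀ j, L j ≠ 0) {q : AnisoHeis L} : hsq L q = 0 ↔ q.1 = 0 := by
  constructor
  · intro h
    funext i
    have := (Finset.sum_eq_zero_iff_of_nonneg
      fun i _ => mul_nonneg (normSq_nonneg i) (sq_nonneg _)).1 h i (Finset.mem_univ i)
    exact pow_eq_zero_iff two_ne_zero |>.1
      ((mul_eq_zero.1 this).resolve_left (normSq_pos hL i).ne')
  · intro h
    simp [hsq, h]

theorem gauge4_pos (hL : ∀ j, L j ≠ 0) {q : AnisoHeis L} (hq : q ≠ 1) : 0 < gauge4 L q := by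
  refine lt_of_le_of_ne (gauge4_nonneg q) fun h => hq ?_
  unfold gauge4 at h
  have h1 : hsq L q = 0 := by nlinarith [sq_nonneg (hsq L q), sq_nonneg q.2]
  have h2 : q.2 = 0 := by nlinarith [sq_nonneg (hsq L q), sq_nonneg q.2]
  exact (ext_iff' L).2 ⟨fun i => by rw [(hsq_eq_zero hL).1 h1]; rfl, h2⟩

theorem rho_pos (hL : ∀ j, L j ≠ 0) {q : AnisoHeis L} (hq : q ≠ 1) : 0 < rho L q := by
  rw [rho_eq]; exact Real.rpow_pos_of_pos (gauge4_pos hL hq) _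

theorem rho_one : rho L (1 : AnisoHeis L) = 0 := by
  rw [rho_eq]
  simp [gauge4, hsq, one_eq_zero]

theorem hsq_le_rho_sq (q : AnisoHeis L) : hsq L q ≤ rho L q ^ 2 := by
  have h := rho_pow_four q
  unfold gauge4 at h
  nlinarith [hsq_nonneg q, sq_nonneg q.2, sq_nonneg (rho L q)]

variable (L) in
theorem contDiff_hsq : ContDiff ℝ ∞ (hsq L) :=
  ContDiff.sum fun i _ => contDiff_const.mul ((coord L i).contDiff.pow 2)

variable (L) in
theorem contDiff_gauge4 : ContDiff ℝ ∞ (gauge4 L) :=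
  ((contDiff_hsq L).pow 2).add (contDiff_const.mul ((sndL L).contDiff.pow 2))

variable (L) in
theorem continuous_rho : Continuous (rho L) := by
  have : rho L = fun q => gauge4 L q ^ (1 / 4 : ℝ) := funext rho_eq
  rw [this]
  exact (contDiff_gauge4 L).continuous.rpow_const fun _ => Or.inr (by norm_num)

theorem contDiffAt_rho (hL : ∀ j, L j ≠ 0) {q : AnisoHeis L} (hq : q ≠ 1) :
    ContDiffAt ℝ ∞ (rho L) q := by
  have : rho L = fun q => gauge4 L q ^ (1 / 4 : ℝ) := funext rho_eq
  rw [this]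
  exact (contDiff_gauge4 L).contDiffAt.rpow_const_of_ne (gauge4_pos hL hq).ne'

theorem hasFDerivAt_hsq (q : AnisoHeis L) :
    HasFDerivAt (hsq L) (∑ i, (2 * normSq L i * q.1 i) • coord L i) q := by
  have h : ∀ i ∈ Finset.univ, HasFDerivAt (fun q : AnisoHeis L => normSq L i * q.1 i ^ 2)
      ((2 * normSq L i * q.1 i) • coord L i) q := fun i _ => by
    have := (((coord L i).hasFDerivAt (x := q)).pow 2).const_mul (normSq L i)
    refine this.congr_fderiv ?_
    ext v
    simp
    ring
  exact HasFDerivAt.fun_sum h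

theorem fderiv_hsq (q v : AnisoHeis L) :
    fderiv ℝ (hsq L) q v = 2 * ∑ i, normSq L i * q.1 i * v.1 i := by
  rw [(hasFDerivAt_hsq q).fderiv, sum_apply, Finset.mul_sum]
  exact Finset.sum_congr rfl fun i _ => by simp; ring

theorem differentiableAt_rho (hL : ∀ j, L j ≠ 0) {q : AnisoHeis L} (hq : q ≠ 1) :
    DifferentiableAt ℝ (rho L) q := (contDiffAt_rho hL hq).differentiableAt (by simp)

/-- Differentiating the polynomial identity `ρ⁴ = s² + 16 t²` and dividing by `4ρ³` avoids
fractional powers. -/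
theorem fderiv_rho (hL : ∀ j, L j ≠ 0) {q : AnisoHeis L} (hq : q ≠ 1) (v : AnisoHeis L) :
    fderiv ℝ (rho L) q v =
      (hsq L q * (∑ i, normSq L i * q.1 i * v.1 i) + 8 * q.2 * v.2) / rho L q ^ 3 := by
  have hd := (differentiableAt_rho hL hq).hasFDerivAt
  have h1 := hd.pow 4
  have h2 := ((hasFDerivAt_hsq q).pow 2).add
    ((((sndL L).hasFDerivAt (x := q)).pow 2).const_mul 16)
  have h3 : (fun q => rho L q ^ 4) = (fun q => hsq L q ^ 2 + 16 * sndL L q ^ 2) :=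
    funext rho_pow_four
  have h4 := congrArg (fun f : AnisoHeis L →L[ℝ] ℝ => f v)
    (HasFDerivAt.unique (h3 ▸ h1 : HasFDerivAt (fun q => hsq L q ^ 2 + 16 * sndL L q ^ 2) _ q) h2)
  have h5 := fderiv_hsq q v
  rw [(hasFDerivAt_hsq q).fderiv] at h5
  simp only [add_apply, smul_apply, h5, sndL_apply, smul_eq_mul] at h4
  rw [eq_div_iff (pow_pos (rho_pos hL hq) 3).ne']
  norm_num [-Fintype.sum_sum_type] at h4
  linear_combination (1 / 4) * h4

/-! ### Dilations, rotations and the horizontal gradient of the gauge -/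

variable (L) in
/-- The generator `∑ i, x_i ∂_{x_i} + 2 t ∂_t` of the dilations. -/
def dilGen : AnisoHeis L →L[ℝ] AnisoHeis L :=
  ContinuousLinearMap.id ℝ _ + (vert L).comp (sndL L)

@[simp] theorem dilGen_fst (q : AnisoHeis L) : (dilGen L q).1 = q.1 := by
  simp [dilGen]

@[simp] theorem dilGen_snd (q : AnisoHeis L) : (dilGen L q).2 = 2 * q.2 := by
  simp [dilGen, two_mul]

theorem fderiv_hsq_dilGen (q : AnisoHeis L) : fderiv ℝ (hsq L) q (dilGen L q) = 2 * hsq L q := by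
  rw [fderiv_hsq, dilGen_fst, hsq]
  congr 1
  exact Finset.sum_congr rfl fun i _ => by ring

theorem symp_self (q : AnisoHeis L) : symp L q q = 0 := by
  have := symp_swap L q q
  linarith

theorem sum_mul_rotGen (q : AnisoHeis L) :
    ∑ i, normSq L i * q.1 i * (rotGen q).1 i = 0 := by
  have := sum_rotGen_mul q q
  rw [symp_self, mul_zero] at this
  rw [← this]
  exact Finset.sum_congr rfl fun i _ => by ring

theorem fderiv_hsq_rotGen (q : AnisoHeis L) : fderiv ℝ (hsq L) q (rotGen q) = 0 := by
  rw [fderiv_hsq, sum_mul_rotGen, mul_zero]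

/-- Euler's identity for a function of homogeneous degree one. -/
theorem fderiv_rho_dilGen (hL : ∀ j, L j ≠ 0) {q : AnisoHeis L} (hq : q ≠ 1) :
    fderiv ℝ (rho L) q (dilGen L q) = rho L q := by
  have h := fderiv_hsq_dilGen q
  rw [fderiv_hsq] at h
  rw [fderiv_rho hL hq, div_eq_iff (pow_pos (rho_pos hL hq) 3).ne', dilGen_snd]
  have := rho_pow_four q
  rw [gauge4] at this
  linear_combination (1 / 2) * hsq L q * h - this

theorem fderiv_rho_rotGen (hL : ∀ j, L j ≠ 0) {q : AnisoHeis L} (hq : q ≠ 1) :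
    fderiv ℝ (rho L) q (rotGen q) = 0 := by
  rw [fderiv_rho hL hq, sum_mul_rotGen, rotGen_snd]
  simp

variable (L) in
/-- The horizontal gradient `∑ i, (X_i f / ‖X_i‖²) X_i`. -/
def hgrad (f : AnisoHeis L → ℝ) (q : AnisoHeis L) : AnisoHeis L :=
  ∑ i, (XDeriv L i f q / normSq L i) • X L i q

theorem gradInner_eq_fderiv (f g : AnisoHeis L → ℝ) (q : AnisoHeis L) :
    gradInner L (fun i => XDeriv L i f q) (fun i => XDeriv L i g q)
      = fderiv ℝ g q (hgrad L f q) := by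
  rw [hgrad, map_sum, gradInner]
  refine Finset.sum_congr rfl fun i _ => ?_
  rw [map_smul, smul_eq_mul, XDeriv, XDeriv]
  ring

theorem XDeriv_rho_inl (hL : ∀ j, L j ≠ 0) {q : AnisoHeis L} (hq : q ≠ 1) (j : Fin n) :
    XDeriv L (.inl j) (rho L) q =
      (hsq L q * normSq L (.inl j) * q.1 (.inl j) - 8 * q.2 * L j * q.1 (.inr j))
        / rho L q ^ 3 := by
  rw [XDeriv, fderiv_rho hL hq, X_snd_inl, X_fst]
  congr 1
  simp [Pi.single_apply]
  ring

theorem XDeriv_rho_inr (hL : ∀ j, L j ≠ 0) {q : AnisoHeis L} (hq : q ≠ 1) (j : Fin n) :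
    XDeriv L (.inr j) (rho L) q =
      (hsq L q * normSq L (.inr j) * q.1 (.inr j) + 8 * q.2 * L j * q.1 (.inl j))
        / rho L q ^ 3 := by
  rw [XDeriv, fderiv_rho hL hq, X_snd_inr, X_fst]
  congr 1
  simp [Pi.single_apply]
  ring

/-- The horizontal gradient of the gauge splits into a dilation and a rotation. -/
theorem hgrad_rho (hL : ∀ j, L j ≠ 0) {q : AnisoHeis L} (hq : q ≠ 1) :
    hgrad L (rho L) q = (hsq L q / rho L q ^ 3) • dilGen L q
      + (4 * q.2 / rho L q ^ 3) • rotGen q := by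
  have hr := (rho_pos hL hq).ne'
  have h1 : (hgrad L (rho L) q).1 = ∑ i, (XDeriv L i (rho L) q / normSq L i) • (X L i q).1 :=
    map_sum (fstL L) _ _
  have h2 : (hgrad L (rho L) q).2 = ∑ i, (XDeriv L i (rho L) q / normSq L i) * (X L i q).2 :=
    map_sum (sndL L) _ _
  have habs : ∀ j, 0 < |L j| := fun j => abs_pos.2 (hL j)
  refine (ext_iff' L).2 ⟨fun k => ?_, ?_⟩
  · rw [h1]
    have h3 : (∑ i, (XDeriv L i (rho L) q / normSq L i) • (X L i q).1) k
        = XDeriv L k (rho L) q / normSq L k := by simp [Pi.single_apply]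
    rw [h3]
    rcases k with j | j
    · have := habs j
      rw [XDeriv_rho_inl hL hq]
      simp only [normSq, add_fst, smul_fst, dilGen_fst, Pi.add_apply, Pi.smul_apply, smul_eq_mul,
        rotGen_inl]
      -- The drift term has coefficient `L_j/|L_j|`, which is the sign occurring in the rotation.
      have hs := sign_mul_abs (L j)
      field_simp
      linear_combination (8 * q.2 * q.1 (.inr j)) * hs
    · have := habs j
      rw [XDeriv_rho_inr hL hq]
      simp only [normSq, add_fst, smul_fst, dilGen_fst, Pi.add_apply, Pi.smul_apply, smul_eq_mul,
        rotGen_inr]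
      have hs := sign_mul_abs (L j)
      field_simp
      linear_combination -(8 * q.2 * q.1 (.inl j)) * hs
  · rw [h2, Fintype.sum_sum_type, ← Finset.sum_add_distrib]
    -- In each pair the terms in `x_j x_{j+n}` cancel, and `L_j² = |L_j|²` turns the rest into `w_j
    -- (x_j² + x_{j+n}²)`; summing yields `s` times the vertical part of the dilation field.
    have h4 : ∀ j, XDeriv L (.inl j) (rho L) q / normSq L (.inl j) * (X L (.inl j) q).2
        + XDeriv L (.inr j) (rho L) q / normSq L (.inr j) * (X L (.inr j) q).2
        = 2 * q.2 / rho L q ^ 3 * (normSq L (.inl j) * q.1 (.inl j) ^ 2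
          + normSq L (.inr j) * q.1 (.inr j) ^ 2) := fun j => by
      have := habs j
      rw [XDeriv_rho_inl hL hq, XDeriv_rho_inr hL hq, X_snd_inl, X_snd_inr]
      simp only [normSq]
      have hs := abs_mul_abs_self (L j)
      field_simp
      linear_combination -8 * q.2 * (q.1 (.inl j) ^ 2 + q.1 (.inr j) ^ 2) * hs
    simp only [h4]
    rw [← Finset.mul_sum, Finset.sum_add_distrib, ← Fintype.sum_sum_type
      (fun i => normSq L i * q.1 i ^ 2), ← hsq]
    simp
    ring

/-- `‖∇₀ρ‖²` is the derivative of `ρ` along `∇₀ρ`, where only the dilation part contributes: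
`(s/ρ³)·ρ`. -/
theorem gradInner_rho_self (hL : ∀ j, L j ≠ 0) {q : AnisoHeis L} (hq : q ≠ 1) :
    gradInner L (fun i => XDeriv L i (rho L) q) (fun i => XDeriv L i (rho L) q)
      = hsq L q / rho L q ^ 2 := by
  have hr := (rho_pos hL hq).ne'
  rw [gradInner_eq_fderiv, hgrad_rho hL hq, map_add, map_smul, map_smul, fderiv_rho_dilGen hL hq,
    fderiv_rho_rotGen hL hq, smul_eq_mul, smul_zero, add_zero]
  field_simp

/-! ### The infinity-Laplacian of the gauge -/

variable (L) in
theorem contDiff_X (i : Fin n ⊕ Fin n) : ContDiff ℝ ∞ (X L i) := by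
  have : X L i = fun q => X L i 1 + vert L ((symp L).flip (X L i 1) q) := funext fun q => X_eq L i q
  rw [this]
  exact contDiff_const.add ((vert L).contDiff.comp ((symp L).flip (X L i 1)).contDiff)

theorem contDiffAt_XDeriv {f : AnisoHeis L → ℝ} {q : AnisoHeis L} (hf : ContDiffAt ℝ ∞ f q)
    (i : Fin n ⊕ Fin n) : ContDiffAt ℝ ∞ (XDeriv L i f) q :=
  (hf.fderiv_right (m := ∞) (by simp)).clm_apply (contDiff_X L i).contDiffAt

/-- `Δ_∞ f = ½ ⟨∇₀ f, ∇₀ ‖∇₀ f‖²⟩`. -/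
theorem infLaplacian_eq {f : AnisoHeis L → ℝ} {q : AnisoHeis L} (hf : ContDiffAt ℝ ∞ f q) :
    infLaplacian L f q = 1 / 2 * fderiv ℝ (fun q => gradInner L (fun i => XDeriv L i f q)
      (fun i => XDeriv L i f q)) q (hgrad L f q) := by
  have hd : ∀ j, HasFDerivAt (XDeriv L j f) (fderiv ℝ (XDeriv L j f) q) q := fun j =>
    ((contDiffAt_XDeriv hf j).differentiableAt (by simp)).hasFDerivAt
  have hs := HasFDerivAt.fun_sum (u := Finset.univ) fun j _ =>
    ((hd j).fun_mul (hd j)).mul_const (normSq L j)⁻¹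
  have hg : (fun q => gradInner L (fun i => XDeriv L i f q) (fun i => XDeriv L i f q))
      = fun q => ∑ j, XDeriv L j f q * XDeriv L j f q * (normSq L j)⁻¹ :=
    funext fun q => Finset.sum_congr rfl fun j _ => div_eq_mul_inv _ _
  rw [hg, hs.fderiv, infLaplacian, hgrad, map_sum, Finset.mul_sum]
  refine Finset.sum_congr rfl fun i _ => ?_
  rw [map_smul, sum_apply, smul_eq_mul, Finset.mul_sum, Finset.mul_sum]
  refine Finset.sum_congr rfl fun j _ => ?_
  simp only [add_apply, smul_apply, smul_eq_mul]
  change _ = 1 / 2 * (XDeriv L i f q / normSq L i * ((normSq L j)⁻¹ *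
    (XDeriv L j f q * XDeriv L i (XDeriv L j f) q + XDeriv L j f q * XDeriv L i (XDeriv L j f) q)))
  rw [one_div, mul_inv]
  ring

/-- `‖∇₀ρ‖² = s/ρ²` is homogeneous of degree zero and rotation invariant, so both components of
`∇₀ρ` annihilate it. -/
theorem infLaplacian_rho (hL : ∀ j, L j ≠ 0) {q : AnisoHeis L} (hq : q ≠ 1) :
    infLaplacian L (rho L) q = 0 := by
  have hr := rho_pos hL hq
  rw [infLaplacian_eq (contDiffAt_rho hL hq)]
  have he : (fun q => gradInner L (fun i => XDeriv L i (rho L) q) (fun i => XDeriv L i (rho L) q))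
      =ᶠ[nhds q] fun q => hsq L q * (rho L q ^ 2)⁻¹ := by
    filter_upwards [isOpen_ne.mem_nhds hq] with y hy using
      (gradInner_rho_self hL hy).trans (div_eq_mul_inv _ _)
  have hp := (differentiableAt_rho hL hq).hasFDerivAt.pow 2
  have hi := HasDerivAt.comp_hasFDerivAt (f := fun y => rho L y ^ 2) q
    (hasDerivAt_inv (pow_pos hr 2).ne') hp
  have hd := (hasFDerivAt_hsq q).differentiableAt.hasFDerivAt.fun_mul hi
  rw [he.fderiv_eq]
  refine (congrArg (fun A : AnisoHeis L →L[ℝ] ℝ => 1 / 2 * A (hgrad L (rho L) q)) hd.fderiv).trans ?_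
  rw [hgrad_rho hL hq]
  simp only [map_add, map_smul, smul_apply, add_apply, fderiv_hsq_dilGen, fderiv_hsq_rotGen,
    fderiv_rho_dilGen hL hq, fderiv_rho_rotGen hL hq, smul_eq_mul, Function.comp_apply]
  field_simp
  ring

/-! ### Lebesgue measure under dilations and polar coordinates -/

instance : (volume : Measure (AnisoHeis L)).IsAddHaarMeasure :=
  Measure.prod.instIsAddHaarMeasure (volume : Measure (Fin n ⊕ Fin n → ℝ)) (volume : Measure ℝ)

instance : NullSingletonClass (volume : Measure (AnisoHeis L)) :=
  Measure.prod.instNullSingletonClass_snd (μ := (volume : Measure (Fin n ⊕ Fin n → ℝ)))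
    (ν := (volume : Measure ℝ))

instance : SigmaFinite (volume : Measure (AnisoHeis L)) :=
  Measure.prod.instSigmaFinite (μ := (volume : Measure (Fin n ⊕ Fin n → ℝ)))
    (ν := (volume : Measure ℝ))

theorem homDim_pos : 0 < homDim L := by unfold homDim; positivity

@[simp] theorem dil_fst (r : ℝ) (q : AnisoHeis L) : (dil L r q).1 = r • q.1 := rfl
@[simp] theorem dil_snd (r : ℝ) (q : AnisoHeis L) : (dil L r q).2 = r ^ 2 * q.2 := rfl

theorem hsq_dil (r : ℝ) (q : AnisoHeis L) : hsq L (dil L r q) = r ^ 2 * hsq L q := by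
  rw [hsq, hsq, Finset.mul_sum]
  exact Finset.sum_congr rfl fun i _ => by simp; ring

theorem rho_dil {r : ℝ} (hr : 0 ≤ r) (q : AnisoHeis L) : rho L (dil L r q) = r * rho L q := by
  refine (pow_left_inj₀ (rho_nonneg _) (mul_nonneg hr (rho_nonneg _)) four_ne_zero).1 ?_
  rw [mul_pow, rho_pow_four, rho_pow_four, gauge4, gauge4, hsq_dil, dil_snd]
  ring

variable (L) in
theorem continuous_uncurry_dil : Continuous fun z : AnisoHeis L × ℝ => dil L z.2 z.1 := by
  have h1 : Continuous fun z : AnisoHeis L × ℝ => z.1.1 := (fstL L).continuous.comp continuous_fst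
  have h2 : Continuous fun z : AnisoHeis L × ℝ => z.1.2 := (sndL L).continuous.comp continuous_fst
  exact (continuous_snd.smul h1).prodMk ((continuous_snd.pow 2).mul h2)

theorem map_dil {r : ℝ} (hr : 0 < r) :
    Measure.map (dil L r) volume = ENNReal.ofReal (r ^ (-homDim L)) • volume := by
  have h1 := Measure.map_addHaar_smul (volume : Measure (Fin n ⊕ Fin n → ℝ)) hr.ne'
  have h2 := Measure.map_addHaar_smul (volume : Measure ℝ) (pow_pos hr 2).ne'
  have h3 := Measure.map_prod_map (volume : Measure (Fin n ⊕ Fin n → ℝ)) (volume : Measure ℝ)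
    (f := fun x => r • x) (g := fun t => r ^ 2 • t) (measurable_const_smul r)
    (measurable_const_smul (r ^ 2))
  rw [h1, h2, Measure.prod_smul_left, Measure.prod_smul_right, smul_smul,
    ← ENNReal.ofReal_mul (abs_nonneg _), ← abs_mul, ← mul_inv] at h3
  refine h3.symm.trans ?_
  congr 2
  rw [abs_of_pos (by positivity), Real.rpow_neg hr.le, homDim,
    show (2 * (n : ℝ) + 2) = ((2 * n + 2 : ℕ) : ℝ) by push_cast; ring, Real.rpow_natCast]
  simp
  ring

theorem measurable_dil (r : ℝ) : Measurable (dil L r) :=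
  ((continuous_uncurry_dil L).comp (continuous_id.prodMk continuous_const)).measurable

theorem lintegral_comp_dil {r : ℝ} (hr : 0 < r) {f : AnisoHeis L → ℝ≥0∞} (hf : Measurable f) :
    ∫⁻ q, f q = ENNReal.ofReal (r ^ homDim L) * ∫⁻ q, f (dil L r q) := by
  rw [← lintegral_map hf (measurable_dil r), map_dil hr, lintegral_smul_measure, smul_eq_mul,
    ← mul_assoc, ← ENNReal.ofReal_mul (by positivity), ← Real.rpow_add hr, add_neg_cancel,
    Real.rpow_zero, ENNReal.ofReal_one, one_mul]

theorem ae_ne_one : ∀ᵐ q : AnisoHeis L, q ≠ 1 := by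
  have := Measure.ae_ne (volume : Measure (AnisoHeis L)) 1
  exact this

variable (L) in
/-- The density of Lebesgue measure in the coordinates `dil r q`, `ρ(q) < 1`, `r > 0`. -/
def polarDensity (z : AnisoHeis L × ℝ) : ℝ :=
  homDim L * rho L z.1 ^ homDim L * z.2 ^ (homDim L - 1)

variable (L) in
theorem measurable_polarDensity : Measurable (polarDensity L) :=
  (((continuous_rho L).measurable.comp measurable_fst).pow_const _ |>.const_mul _).mul
    (measurable_snd.pow_const _)

variable (L) in
/-- The product measure on `{ρ < 1} × (0, ∞)`. -/
def polarBase : Measure (AnisoHeis L × ℝ) :=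
  (volume.restrict {q | rho L q < 1}).prod (volume.restrict (Ioi 0))

theorem measurableSet_rho_lt (R : ℝ) : MeasurableSet {q | rho L q < R} :=
  (isOpen_lt (continuous_rho L) continuous_const).measurableSet

variable (L) in
/-- A function with `∫_0^∞ radialKernel L q r dr = 1` which is supported in `ρ(q) < r`. -/
def radialKernel (q : AnisoHeis L) (r : ℝ) : ℝ≥0∞ :=
  {z : AnisoHeis L × ℝ | rho L z.1 < z.2}.indicator
    (fun z => ENNReal.ofReal (homDim L * rho L z.1 ^ homDim L * z.2 ^ (-homDim L - 1))) (q, r)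

variable (L) in
theorem measurable_radialKernel : Measurable (Function.uncurry (radialKernel L)) := by
  have hρ := (continuous_rho L).measurable.comp
    (measurable_fst : Measurable (Prod.fst : AnisoHeis L × ℝ → AnisoHeis L))
  exact (((hρ.pow_const _).const_mul _).mul (measurable_snd.pow_const _)).ennreal_ofReal.indicator
    (measurableSet_lt hρ measurable_snd)

/-- The factor `Qρ^Q` normalises `∫_ρ^∞ r^{-Q-1} dr = ρ^{-Q}/Q`. -/
theorem lintegral_radialKernel {q : AnisoHeis L} (hq : 0 < rho L q) :
    ∫⁻ r in Ioi (0 : ℝ), radialKernel L q r = 1 := by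
  have hQ := homDim_pos (L := L)
  have hk : ∀ r, radialKernel L q r = (Ioi (rho L q)).indicator
      (fun r => ENNReal.ofReal (homDim L * rho L q ^ homDim L * r ^ (-homDim L - 1))) r :=
    fun r => by simp only [radialKernel, indicator, mem_Ioi, mem_ofPred_eq]
  simp only [hk]
  rw [setLIntegral_indicator measurableSet_Ioi, inter_eq_left.2 (Ioi_subset_Ioi hq.le),
    ← ofReal_integral_eq_lintegral_ofReal, integral_const_mul, integral_Ioi_rpow_of_lt (by linarith)
    hq, sub_add_cancel, Real.rpow_neg hq.le, ENNReal.ofReal_eq_one]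
  · have := Real.rpow_pos_of_pos hq (homDim L)
    field_simp
  · exact (integrableOn_Ioi_rpow_of_lt (by linarith) hq).const_mul _
  · filter_upwards [ae_restrict_mem measurableSet_Ioi] with r hr
    have : 0 < r := hq.trans hr
    change (0 : ℝ) ≤ _
    positivity

/-- After rescaling by `r` the constraint `ρ < r` becomes `ρ < 1`, so the two variables range over a
product. -/
theorem radialKernel_dil {r : ℝ} (hr : 0 < r) (q : AnisoHeis L) :
    ENNReal.ofReal (r ^ homDim L) * radialKernel L (dil L r q) r
      = {q | rho L q < 1}.indicator (fun q => ENNReal.ofReal (polarDensity L (q, r))) q := by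
  simp only [indicator, mem_ofPred_eq, radialKernel, rho_dil hr.le, mul_lt_iff_lt_one_right hr]
  split_ifs with h
  · rw [← ENNReal.ofReal_mul (by positivity)]
    congr 1
    have e : r ^ (homDim L - 1) = r ^ homDim L * r ^ homDim L * r ^ (-homDim L - 1) := by
      rw [← Real.rpow_add hr, ← Real.rpow_add hr]
      congr 1
      ring
    rw [polarDensity, Real.mul_rpow hr.le (rho_nonneg q), e]
    ring
  · simp

/-- Polar coordinates with the solid unit ball in place of a surface measure on the sphere: insert
the kernel of total mass one, exchange the integrals by Tonelli, and substitute `q ↦ dil r q` for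
each fixed `r`. -/
theorem lintegral_polar (hL : ∀ j, L j ≠ 0) {f : AnisoHeis L → ℝ≥0∞} (hf : Measurable f) :
    ∫⁻ q, f q = ∫⁻ z, ENNReal.ofReal (polarDensity L z) * f (dil L z.2 z.1) ∂(polarBase L) := by
  have hm : Measurable fun z : AnisoHeis L × ℝ =>
      ENNReal.ofReal (polarDensity L z) * f (dil L z.2 z.1) :=
    (measurable_polarDensity L).ennreal_ofReal.mul
      (hf.comp (continuous_uncurry_dil L).measurable)
  have hk1 : ∀ q, Measurable (radialKernel L q) := fun q =>
    (measurable_radialKernel L).of_uncurry_left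
  have hk2 : ∀ r, Measurable fun q => radialKernel L q r * f q := fun r =>
    (measurable_radialKernel L).of_uncurry_right.mul hf
  rw [polarBase, lintegral_prod_symm _ hm.aemeasurable]
  calc ∫⁻ q, f q = ∫⁻ q, ∫⁻ r in Ioi (0 : ℝ), radialKernel L q r * f q := by
        refine lintegral_congr_ae ?_
        filter_upwards [ae_ne_one] with q hq
        rw [lintegral_mul_const _ (hk1 q), lintegral_radialKernel (rho_pos hL hq), one_mul]
    _ = ∫⁻ r in Ioi (0 : ℝ), ∫⁻ q, radialKernel L q r * f q :=
        lintegral_lintegral_swap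
          ((measurable_radialKernel L).mul (hf.comp measurable_fst)).aemeasurable
    _ = _ := by
        refine setLIntegral_congr_fun measurableSet_Ioi fun r hr => ?_
        have hr : 0 < r := hr
        have hk3 : Measurable fun q => radialKernel L (dil L r q) r * f (dil L r q) :=
          (hk2 r).comp (measurable_dil r)
        rw [lintegral_comp_dil hr (hk2 r), ← lintegral_const_mul _ hk3,
          ← lintegral_indicator (measurableSet_rho_lt 1)]
        refine lintegral_congr fun q => ?_
        rw [← mul_assoc, radialKernel_dil hr]
        simp only [indicator]
        split_ifs <;> simp

theorem map_polar (hL : ∀ j, L j ≠ 0) :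
    Measure.map (fun z => dil L z.2 z.1)
      ((polarBase L).withDensity fun z => ENNReal.ofReal (polarDensity L z)) = volume := by
  refine Measure.ext_of_lintegral _ fun f hf => ?_
  rw [lintegral_map hf (continuous_uncurry_dil L).measurable, lintegral_polar hL hf]
  exact lintegral_withDensity_eq_lintegral_mul _ (measurable_polarDensity L).ennreal_ofReal
    (hf.comp (continuous_uncurry_dil L).measurable)

theorem ae_polarBase_pos : ∀ᵐ z ∂(polarBase L), 0 < z.2 :=
  Measure.quasiMeasurePreserving_snd.ae (ae_restrict_mem measurableSet_Ioi)

theorem polarDensity_nonneg : ∀ᵐ z ∂(polarBase L), 0 ≤ polarDensity L z := by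
  filter_upwards [ae_polarBase_pos] with z hz
  have := homDim_pos (L := L)
  have := rho_nonneg z.1
  unfold polarDensity
  positivity

/-- Integration in polar coordinates. -/
theorem integral_polar (hL : ∀ j, L j ≠ 0) {f : AnisoHeis L → ℝ} (hf : Integrable f) :
    Integrable (fun z => polarDensity L z * f (dil L z.2 z.1)) (polarBase L) ∧
      ∫ q, f q = ∫ z, polarDensity L z * f (dil L z.2 z.1) ∂(polarBase L) := by
  have hd := (continuous_uncurry_dil L).measurable.aemeasurable (μ := (polarBase L).withDensity
    fun z => ENNReal.ofReal (polarDensity L z))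
  have hp := (measurable_polarDensity L).ennreal_ofReal
  have htop : ∀ᵐ z ∂(polarBase L), ENNReal.ofReal (polarDensity L z) < ⊤ :=
    Filter.Eventually.of_forall fun _ => ENNReal.ofReal_lt_top
  have he : (fun z => (ENNReal.ofReal (polarDensity L z)).toReal • f (dil L z.2 z.1))
      =ᵐ[polarBase L] fun z => polarDensity L z * f (dil L z.2 z.1) := by
    filter_upwards [polarDensity_nonneg] with z hz
    rw [ENNReal.toReal_ofReal hz, smul_eq_mul]
  rw [← map_polar hL] at hf
  constructor
  · refine Integrable.congr ?_ he
    exact (integrable_withDensity_iff_integrable_smul' hp htop).1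
      ((integrable_map_measure hf.1 hd).1 hf)
  · conv_lhs => rw [← map_polar hL]
    rw [integral_map hd hf.1, integral_withDensity_eq_integral_toReal_smul hp htop]
    exact integral_congr_ae he

/-! ### Comparison of the gauge with the norm, and local integrability -/

theorem exists_norm_fst_le (hL : ∀ j, L j ≠ 0) :
    ∃ c : ℝ, 0 ≤ c ∧ ∀ q : AnisoHeis L, ‖q.1‖ ≤ c * Real.sqrt (hsq L q) := by
  refine ⟨∑ i, (Real.sqrt (normSq L i))⁻¹, Finset.sum_nonneg fun i _ => by positivity, fun q => ?_⟩
  refine (pi_norm_le_iff_of_nonneg (by positivity)).2 fun i => ?_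
  have hw := Real.sqrt_pos.2 (normSq_pos hL i)
  have h1 : Real.sqrt (normSq L i) * |q.1 i| ≤ Real.sqrt (hsq L q) := by
    rw [← Real.sqrt_sq_eq_abs, ← Real.sqrt_mul (normSq_nonneg i)]
    exact Real.sqrt_le_sqrt (Finset.single_le_sum
      (f := fun i => normSq L i * q.1 i ^ 2)
      (fun i _ => mul_nonneg (normSq_nonneg i) (sq_nonneg _)) (Finset.mem_univ i))
  calc ‖q.1 i‖ ≤ (Real.sqrt (normSq L i))⁻¹ * Real.sqrt (hsq L q) := by
        rw [Real.norm_eq_abs, inv_mul_eq_div, le_div_iff₀ hw, mul_comm]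
        exact h1
    _ ≤ _ := mul_le_mul_of_nonneg_right (Finset.single_le_sum
      (f := fun i => (Real.sqrt (normSq L i))⁻¹) (fun i _ => by positivity) (Finset.mem_univ i))
      (Real.sqrt_nonneg _)

theorem sqrt_hsq_le_rho (q : AnisoHeis L) : Real.sqrt (hsq L q) ≤ rho L q :=
  Real.sqrt_le_iff.2 ⟨rho_nonneg q, hsq_le_rho_sq q⟩

theorem four_mul_abs_snd_le (q : AnisoHeis L) : 4 * |q.2| ≤ rho L q ^ 2 := by
  refine abs_le_of_sq_le_sq' ?_ (sq_nonneg _) |>.2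
  have := rho_pow_four q
  rw [gauge4] at this
  rw [mul_pow, sq_abs, ← pow_mul, this]
  nlinarith [sq_nonneg (hsq L q)]

theorem volume_rho_lt_one (hL : ∀ j, L j ≠ 0) : volume {q | rho L q < 1} < ⊤ := by
  obtain ⟨c, hc, h⟩ := exists_norm_fst_le hL
  refine (Bornology.IsBounded.subset (Metric.isBounded_closedBall (x := (0 : AnisoHeis L))
    (r := max c 1)) fun q hq => ?_).measure_lt_top
  have hq : rho L q < 1 := hq
  rw [mem_closedBall_zero_iff]
  refine max_le_max ?_ ?_
  · exact (h q).trans (mul_le_of_le_one_right hc ((sqrt_hsq_le_rho q).trans hq.le))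
  · have := four_mul_abs_snd_le q
    change |q.2| ≤ 1
    nlinarith [rho_nonneg q, abs_nonneg q.2]

/-- `ρ^{1-Q}` is locally integrable. -/
theorem integrableOn_rho_rpow (hL : ∀ j, L j ≠ 0) (R : ℝ) :
    IntegrableOn (fun q => rho L q ^ (1 - homDim L)) {q | rho L q < R} := by
  have hρ := (continuous_rho L).measurable
  have hm : Measurable fun q => rho L q ^ (1 - homDim L) := hρ.pow_const _
  refine ⟨hm.aestronglyMeasurable, ?_⟩
  rw [hasFiniteIntegral_iff_ofReal (Filter.Eventually.of_forall fun q =>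
    Real.rpow_nonneg (rho_nonneg q) _), ← lintegral_indicator (measurableSet_rho_lt R)]
  have hm2 := (hm.ennreal_ofReal).indicator (measurableSet_rho_lt (L := L) R)
  rw [lintegral_polar hL hm2, polarBase, lintegral_prod _ (by
    exact ((measurable_polarDensity L).ennreal_ofReal.mul
      (hm2.comp (continuous_uncurry_dil L).measurable)).aemeasurable)]
  -- For fixed `q` the density times `(rρ)^{1-Q}` is the constant `Qρ(q)` on `0 < r < R/ρ(q)`, so
  -- the radial integral is `QR` for every `q`.
  have hb : ∀ᵐ q ∂(volume.restrict {q | rho L q < 1}),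
      ∫⁻ r in Ioi (0 : ℝ), ENNReal.ofReal (polarDensity L (q, r)) *
        ({q | rho L q < R}.indicator (fun q => ENNReal.ofReal (rho L q ^ (1 - homDim L)))
          (dil L r q)) ≤ ENNReal.ofReal (homDim L * R) := by
    filter_upwards [ae_restrict_of_ae ae_ne_one] with q hq
    have hq := rho_pos hL hq
    have hQ := homDim_pos (L := L)
    calc _ ≤ ∫⁻ r in Ioi (0 : ℝ), (Iio (R / rho L q)).indicator
            (fun _ => ENNReal.ofReal (homDim L * rho L q)) r := by
          refine setLIntegral_mono' measurableSet_Ioi fun r hr => ?_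
          have hr : 0 < r := hr
          simp only [indicator, mem_ofPred_eq, rho_dil hr.le, mem_Iio, lt_div_iff₀ hq]
          split_ifs with h
          · rw [← ENNReal.ofReal_mul' (by positivity)]
            refine le_of_eq ?_
            congr 1
            have e1 : r ^ (1 - homDim L) = (r ^ (homDim L - 1))⁻¹ := by
              rw [← Real.rpow_neg hr.le, neg_sub]
            have e2 : rho L q ^ (1 - homDim L) = rho L q * (rho L q ^ homDim L)⁻¹ := by
              rw [Real.rpow_sub hq, Real.rpow_one, div_eq_mul_inv]
            have h1 := (Real.rpow_pos_of_pos hr (homDim L - 1)).ne'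
            have h2 := (Real.rpow_pos_of_pos hq (homDim L)).ne'
            rw [polarDensity, Real.mul_rpow hr.le hq.le, e1, e2]
            field_simp
          · simp
      _ = ENNReal.ofReal (homDim L * R) := by
          rw [setLIntegral_indicator measurableSet_Iio, lintegral_const, Measure.restrict_apply_univ,
            inter_comm, Ioi_inter_Iio, Real.volume_Ioo, ← ENNReal.ofReal_mul (by positivity)]
          congr 1
          field_simp
          ring
  refine (lintegral_mono_ae hb).trans_lt ?_
  rw [lintegral_const, Measure.restrict_apply_univ]
  exact ENNReal.mul_lt_top ENNReal.ofReal_lt_top (volume_rho_lt_one hL)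

/-! ### The rotation flow and averaging over its orbits -/

variable (L) in
/-- The flow of the field `rotGen`. -/
def rot (θ : ℝ) : AnisoHeis L →L[ℝ] AnisoHeis L :=
  Real.cos θ • (ContinuousLinearMap.id ℝ _ - (vert L).comp (sndL L)) + Real.sin θ • rotGen
    + (vert L).comp (sndL L)

theorem rot_fst (θ : ℝ) (q : AnisoHeis L) (i : Fin n ⊕ Fin n) :
    (rot L θ q).1 i = Real.cos θ * q.1 i + Real.sin θ * (rotGen q).1 i := by
  simp [rot]

@[simp] theorem rot_snd (θ : ℝ) (q : AnisoHeis L) : (rot L θ q).2 = q.2 := by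
  simp [rot]

theorem hsq_rot (hL : ∀ j, L j ≠ 0) (θ : ℝ) (q : AnisoHeis L) : hsq L (rot L θ q) = hsq L q := by
  have h1 := sum_rotGen_mul_rotGen hL q q
  have h2 := sum_mul_rotGen q
  have h3 : hsq L q = ∑ i, normSq L i * q.1 i * q.1 i :=
    Finset.sum_congr rfl fun i _ => by ring
  have h4 : hsq L (rot L θ q) = Real.cos θ ^ 2 * ∑ i, normSq L i * q.1 i * q.1 i
      + 2 * Real.cos θ * Real.sin θ * ∑ i, normSq L i * q.1 i * (rotGen q).1 i
      + Real.sin θ ^ 2 * ∑ i, normSq L i * (rotGen q).1 i * (rotGen q).1 i := by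
    rw [Finset.mul_sum, Finset.mul_sum, Finset.mul_sum, ← Finset.sum_add_distrib,
      ← Finset.sum_add_distrib]
    exact Finset.sum_congr rfl fun i _ => by rw [rot_fst]; ring
  rw [h4, h1, h2, ← h3]
  linear_combination hsq L q * Real.cos_sq_add_sin_sq θ

theorem rho_rot (hL : ∀ j, L j ≠ 0) (θ : ℝ) (q : AnisoHeis L) : rho L (rot L θ q) = rho L q := by
  rw [rho_eq, rho_eq, gauge4, gauge4, hsq_rot hL, rot_snd]

theorem rho_eq_zero (hL : ∀ j, L j ≠ 0) {q : AnisoHeis L} : rho L q = 0 ↔ q = 1 :=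
  ⟨fun h => by_contra fun hq => (rho_pos hL hq).ne' h, fun h => h ▸ rho_one⟩

/-- No determinant is computed: a linear bijection scales Lebesgue measure by a constant, and the
gauge ball, of positive finite measure, is mapped to itself. -/
theorem map_rot (hL : ∀ j, L j ≠ 0) (θ : ℝ) : Measure.map (rot L θ) volume = volume := by
  have hinj : Function.Injective (rot L θ).toLinearMap := by
    refine (injective_iff_map_eq_zero _).2 fun q hq => ?_
    refine (rho_eq_zero hL).1 ?_
    rw [← rho_rot hL θ, show rot L θ q = 1 from hq, rho_one]
  have hdet : LinearMap.det (rot L θ).toLinearMap ≠ 0 :=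
    (LinearEquiv.isUnit_det' (LinearEquiv.ofInjectiveEndo _ hinj)).ne_zero
  have h := Measure.map_linearMap_addHaar_eq_smul_addHaar (volume : Measure (AnisoHeis L)) hdet
  set c := ENNReal.ofReal |(LinearMap.det (rot L θ).toLinearMap)⁻¹|
  have hc : c = 1 := by
    have h1 := congrArg (fun μ : Measure (AnisoHeis L) => μ {q | rho L q < 1}) h
    simp only [Measure.smul_apply, smul_eq_mul] at h1
    rw [Measure.map_apply (f := (rot L θ).toLinearMap) (rot L θ).continuous.measurable
      (measurableSet_rho_lt 1)] at h1
    have h2 : (rot L θ).toLinearMap ⁻¹' {q | rho L q < 1} = {q | rho L q < 1} := by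
      ext q
      change rho L (rot L θ q) < 1 ↔ rho L q < 1
      rw [rho_rot hL]
    rw [h2] at h1
    have hpos : volume {q : AnisoHeis L | rho L q < 1} ≠ 0 :=
      ((isOpen_lt (continuous_rho L) continuous_const).measure_pos volume
        ⟨1, by simp [rho_one]⟩).ne'
    exact ((ENNReal.mul_eq_right hpos (volume_rho_lt_one hL).ne).1 h1.symm)
  rw [hc, one_smul] at h
  exact h

/-- `R² = -1` on horizontal coordinates is what makes `cos θ + sin θ R` the flow of `R`. -/
theorem rotGen_rotGen (hL : ∀ j, L j ≠ 0) (q : AnisoHeis L) (i : Fin n ⊕ Fin n) :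
    (rotGen (rotGen q)).1 i = - q.1 i := by
  rcases i with j | j
  · rw [rotGen_inl, rotGen_inr]
    linear_combination -(q.1 (.inl j)) * sign_mul_sign hL j
  · rw [rotGen_inr, rotGen_inl]
    linear_combination -(q.1 (.inr j)) * sign_mul_sign hL j

theorem hasDerivAt_rot (hL : ∀ j, L j ≠ 0) (q : AnisoHeis L) (θ : ℝ) :
    HasDerivAt (fun θ => rot L θ q) (rotGen (rot L θ q)) θ := by
  have h := (((Real.hasDerivAt_cos θ).smul_const (q - vert L q.2)).add
    ((Real.hasDerivAt_sin θ).smul_const (rotGen q))).add_const (vert L q.2)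
  refine h.congr_deriv ((ext_iff' L).2 ⟨fun i => ?_, by simp⟩)
  have : (rotGen (rot L θ q)).1 i = Real.cos θ * (rotGen q).1 i - Real.sin θ * q.1 i := by
    simp only [rot, add_apply, smul_apply, map_add, map_smul, add_fst, smul_fst, Pi.add_apply,
      Pi.smul_apply, smul_eq_mul, rotGen_rotGen hL]
    rcases i with j | j <;> simp <;> ring
  rw [this]
  simp
  ring

variable (L) in
theorem continuous_uncurry_rot : Continuous fun z : ℝ × AnisoHeis L => rot L z.1 z.2 := by
  have h1 : Continuous fun z : ℝ × AnisoHeis L => vert L (sndL L z.2) :=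
    (vert L).continuous.comp ((sndL L).continuous.comp continuous_snd)
  exact (((Real.continuous_cos.comp continuous_fst).smul (continuous_snd.sub h1)).add
    ((Real.continuous_sin.comp continuous_fst).smul
      ((rotGen (L := L)).continuous.comp continuous_snd))).add h1

theorem continuous_fderiv_apply {φ : AnisoHeis L → ℝ} (hφ : ContDiff ℝ ∞ φ)
    (A : AnisoHeis L →L[ℝ] AnisoHeis L) : Continuous fun q => fderiv ℝ φ q (A q) :=
  (hφ.continuous_fderiv (by simp)).clm_apply A.continuous

theorem integral_comp_rot (hL : ∀ j, L j ≠ 0) {f : AnisoHeis L → ℝ} (hf : Measurable f) (θ : ℝ) :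
    ∫ q, f (rot L θ q) = ∫ q, f q := by
  conv_rhs => rw [← map_rot hL θ]
  exact (integral_map (rot L θ).continuous.measurable.aemeasurable hf.aestronglyMeasurable).symm

theorem integrable_comp_rot (hL : ∀ j, L j ≠ 0) {f : AnisoHeis L → ℝ} (hf : Measurable f)
    (hi : Integrable f) (θ : ℝ) : Integrable fun q => f (rot L θ q) := by
  rw [← map_rot hL θ] at hi
  exact (integrable_map_measure hf.aestronglyMeasurable
    (rot L θ).continuous.measurable.aemeasurable).1 hi

/-- A function whose means over the orbits of the rotations vanish has integral zero. -/
theorem integral_eq_zero_of_mean_rot (hL : ∀ j, L j ≠ 0) {f : AnisoHeis L → ℝ} (hf : Measurable f)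
    (hi : Integrable f) (h : ∀ q, ∫ θ in (0 : ℝ)..2 * Real.pi, f (rot L θ q) = 0) :
    ∫ q, f q = 0 := by
  have hfin : IsFiniteMeasure (volume.restrict (uIoc 0 (2 * Real.pi))) := ⟨by simp [uIoc]⟩
  have hm : Measurable (Function.uncurry fun θ q => f (rot L θ q)) :=
    hf.comp (continuous_uncurry_rot L).measurable
  have hn : ∀ θ, ∫ q, ‖f (rot L θ q)‖ = ∫ q, ‖f q‖ := fun θ => integral_comp_rot hL hf.norm θ
  have hint : Integrable (Function.uncurry fun θ q => f (rot L θ q))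
      ((volume.restrict (uIoc 0 (2 * Real.pi))).prod volume) := by
    refine (integrable_prod_iff hm.aestronglyMeasurable).2
      ⟨Filter.Eventually.of_forall fun θ => integrable_comp_rot hL hf hi θ, ?_⟩
    exact (integrable_const (∫ q, ‖f q‖)).congr (Filter.Eventually.of_forall fun θ => (hn θ).symm)
  -- Exchanging the integrals gives `2π ∫ f = 0`, since every rotated integral equals `∫ f`.
  have hswap := intervalIntegral_integral_swap hint
  simp only [integral_comp_rot hL hf, h] at hswap
  simpa [Real.pi_ne_zero] using hswap

/-- Derivatives along the rotations integrate to zero against rotation invariant weights. -/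
theorem integral_mul_fderiv_rotGen (hL : ∀ j, L j ≠ 0) {g φ : AnisoHeis L → ℝ}
    (hφ : ContDiff ℝ ∞ φ) (hgm : Measurable g) (hg : ∀ θ q, g (rot L θ q) = g q)
    (hi : Integrable fun q => g q * fderiv ℝ φ q (rotGen q)) :
    ∫ q, g q * fderiv ℝ φ q (rotGen q) = 0 := by
  have hc := continuous_fderiv_apply hφ rotGen
  refine integral_eq_zero_of_mean_rot hL (hgm.mul hc.measurable) hi fun q => ?_
  -- Along an orbit the weight is constant and the other factor is `d/dθ φ(rot θ q)`, whose integral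
  -- over a full period is zero.
  have hd : ∀ θ, HasDerivAt (fun θ => φ (rot L θ q))
      (fderiv ℝ φ (rot L θ q) (rotGen (rot L θ q))) θ := fun θ =>
    (hφ.differentiable (by simp) _).hasFDerivAt.comp_hasDerivAt θ (hasDerivAt_rot hL q θ)
  simp only [hg]
  rw [intervalIntegral.integral_const_mul, intervalIntegral.integral_eq_sub_of_hasDerivAt
    (fun θ _ => hd θ)]
  · simp [rot]
  · exact (hc.comp ((continuous_uncurry_rot L).comp
      (continuous_id.prodMk continuous_const))).intervalIntegrable _ _

/-! ### Flux integrals against test functions -/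

/-- A test function vanishes outside of a gauge ball, and its differential is bounded. -/
theorem exists_bounds {φ : AnisoHeis L → ℝ} (hφ : ContDiff ℝ ∞ φ) (hc : HasCompactSupport φ) :
    ∃ R C : ℝ, 0 < R ∧ 0 ≤ C ∧ (∀ q, R ≤ rho L q → φ q = 0 ∧ fderiv ℝ φ q = 0) ∧
      ∀ q, ‖fderiv ℝ φ q‖ ≤ C := by
  obtain ⟨R, hR⟩ := hc.isCompact.bddAbove_image (continuous_rho L).continuousOn
  obtain ⟨C, hC⟩ := (hc.fderiv (𝕜 := ℝ)).exists_bound_of_continuous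
    (hφ.continuous_fderiv (by simp))
  refine ⟨max R 0 + 1, C, by positivity, (norm_nonneg _).trans (hC 1), fun q hq => ?_, hC⟩
  have hq' : q ∉ tsupport φ := fun h => by
    have := hR ⟨q, h, rfl⟩
    have := le_max_left R 0
    linarith
  exact ⟨image_eq_zero_of_notMem_tsupport hq', fderiv_of_notMem_tsupport ℝ hq'⟩

theorem norm_rotGen_le (q : AnisoHeis L) : ‖(rotGen q : AnisoHeis L)‖ ≤ ‖q.1‖ := by
  have hs : ∀ x : ℝ, |(SignType.sign x : ℝ)| ≤ 1 := fun x => by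
    rcases lt_trichotomy x 0 with h | h | h <;> simp [h]
  refine max_le ((pi_norm_le_iff_of_nonneg (norm_nonneg _)).2 fun i => ?_) ?_
  · rcases i with j | j
    · rw [rotGen_inl, norm_mul, norm_neg]
      exact (mul_le_of_le_one_left (norm_nonneg _) (hs _)).trans (norm_le_pi_norm q.1 _)
    · rw [rotGen_inr, norm_mul]
      exact (mul_le_of_le_one_left (norm_nonneg _) (hs _)).trans (norm_le_pi_norm q.1 _)
  · rw [rotGen_snd, norm_zero]
    exact norm_nonneg _

theorem norm_dilGen_le (q : AnisoHeis L) : ‖dilGen L q‖ ≤ ‖q.1‖ + 2 * |q.2| := by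
  refine max_le ?_ ?_
  · rw [dilGen_fst]
    linarith [abs_nonneg q.2]
  · rw [dilGen_snd, norm_mul, Real.norm_eq_abs, Real.norm_eq_abs, abs_two]
    linarith [norm_nonneg q.1]

variable (L) in
/-- The function `‖∇₀ ρ‖ = √s / ρ`. -/
def slope (q : AnisoHeis L) : ℝ := Real.sqrt (hsq L q) / rho L q

theorem slope_nonneg (q : AnisoHeis L) : 0 ≤ slope L q :=
  div_nonneg (Real.sqrt_nonneg _) (rho_nonneg _)

theorem slope_le_one (q : AnisoHeis L) : slope L q ≤ 1 :=
  div_le_one_of_le₀ (sqrt_hsq_le_rho q) (rho_nonneg q)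

variable (L) in
theorem measurable_slope : Measurable (slope L) :=
  (contDiff_hsq L).continuous.sqrt.measurable.div (continuous_rho L).measurable

theorem slope_dil {r : ℝ} (hr : 0 < r) (q : AnisoHeis L) : slope L (dil L r q) = slope L q := by
  rw [slope, slope, hsq_dil, rho_dil hr.le, Real.sqrt_mul (sq_nonneg r), Real.sqrt_sq hr.le,
    mul_div_mul_left _ _ hr.ne']

/-- Functions bounded by `C ρ^{1-Q}` which vanish for `ρ ≥ R` are integrable. -/
theorem integrable_of_le (hL : ∀ j, L j ≠ 0) {f : AnisoHeis L → ℝ} (hf : Measurable f) {R C : ℝ}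
    (hR : ∀ q, R ≤ rho L q → f q = 0) (hC : ∀ q, q ≠ 1 → |f q| ≤ C * rho L q ^ (1 - homDim L)) :
    Integrable f := by
  have h := (integrableOn_rho_rpow hL R).const_mul C
  rw [← integrableOn_iff_integrable_of_support_subset (s := {q | rho L q < R})]
  · refine Integrable.mono' h hf.aestronglyMeasurable ?_
    filter_upwards [ae_restrict_of_ae ae_ne_one] with q hq using hC q hq
  · intro q hq
    by_contra hlt
    exact hq (hR q (not_lt.1 hlt))

theorem hasDerivAt_dil (q : AnisoHeis L) {r : ℝ} (hr : r ≠ 0) :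
    HasDerivAt (fun r => dil L r q) (r⁻¹ • dilGen L (dil L r q)) r := by
  have h1 : HasDerivAt (fun r : ℝ => r • q.1) ((1 : ℝ) • q.1) r := (hasDerivAt_id r).smul_const q.1
  have h2 : HasDerivAt (fun r : ℝ => r ^ 2 * q.2) (2 * r * q.2) r := by
    simpa using (hasDerivAt_pow 2 r).mul_const q.2
  have h3 : HasDerivAt (fun r => dil L r q) _ r := h1.prodMk h2
  refine h3.congr_deriv ((ext_iff' L).2 ⟨fun i => ?_, ?_⟩)
  · rw [smul_fst, dilGen_fst, dil_fst, inv_smul_smul₀ hr]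
    exact one_mul _
  · rw [smul_snd, dilGen_snd, dil_snd]
    change 2 * r * q.2 = _
    field_simp

/-- Test functions are recovered by integrating along the dilations. -/
theorem integral_fderiv_dilGen (hL : ∀ j, L j ≠ 0) {φ : AnisoHeis L → ℝ} (hφ : ContDiff ℝ ∞ φ)
    (hc : HasCompactSupport φ) {q : AnisoHeis L} (hq : q ≠ 1) :
    ∫ r in Ioi (0 : ℝ), r⁻¹ * fderiv ℝ φ (dil L r q) (dilGen L (dil L r q)) = -φ 1 := by
  obtain ⟨R, C, hR0, -, hR, -⟩ := exists_bounds hφ hc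
  have hρ := rho_pos hL hq
  -- The dilation formula is polynomial in `r`, so the ray extends smoothly through `r = 0`, where
  -- it meets the identity.
  have hdil : ContDiff ℝ ∞ fun r : ℝ => dil L r q :=
    (contDiff_id.smul contDiff_const).prodMk ((contDiff_id.pow 2).mul contDiff_const)
  have hsm : ContDiff ℝ ∞ fun r : ℝ => φ (dil L r q) := hφ.comp hdil
  have hcomp : HasCompactSupport fun r : ℝ => φ (dil L r q) := by
    refine HasCompactSupport.intro (isCompact_Icc (a := -(R / rho L q)) (b := R / rho L q))
      fun r hr => (hR _ ?_).1
    have h4 : rho L (dil L r q) = |r| * rho L q := by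
      rw [← rho_dil (abs_nonneg r), rho_eq, rho_eq, gauge4, gauge4, hsq_dil, hsq_dil]
      simp
    rw [h4, ← div_le_iff₀ hρ]
    by_contra hlt
    exact hr (abs_le.1 (not_le.1 hlt).le)
  have h := hcomp.integral_Ioi_deriv_eq (hsm.of_le (by simp)) 0
  have h0 : dil L 0 q = 1 := (ext_iff' L).2 ⟨fun i => by simp [one_eq_zero], by simp [one_eq_zero]⟩
  rw [h0] at h
  rw [← h]
  refine setIntegral_congr_fun measurableSet_Ioi fun r hr => ?_
  have hr : 0 < r := hr
  have hd := (hφ.differentiable (by simp) (dil L r q)).hasFDerivAt.comp_hasDerivAt r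
    (hasDerivAt_dil q hr.ne')
  rw [map_smul, smul_eq_mul] at hd
  exact hd.deriv.symm

/-- Both fields vanish at the identity. The dilation bound supplies the factor `ρ` that lifts
`ρ^{-Q}` to `ρ^{1-Q}`; the sharper bound `√s` for rotations also controls the set `s = 0`. -/
theorem abs_fderiv_dilGen_le (hL : ∀ j, L j ≠ 0) {φ : AnisoHeis L → ℝ} (hφ : ContDiff ℝ ∞ φ)
    (hc : HasCompactSupport φ) : ∃ C : ℝ, 0 ≤ C ∧ ∀ q,
      |fderiv ℝ φ q (dilGen L q)| ≤ C * rho L q ∧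
      |fderiv ℝ φ q (rotGen q)| ≤ C * Real.sqrt (hsq L q) := by
  obtain ⟨R, C, hR0, hC0, hR, hC⟩ := exists_bounds hφ hc
  obtain ⟨c, hc0, hcb⟩ := exists_norm_fst_le hL
  -- For `ρ < R`, `|x| + 2|t| ≤ cρ + ρ²/2 ≤ (c + R)ρ`.
  refine ⟨C * (c + R), by positivity, fun q => ⟨?_, ?_⟩⟩
  · rcases le_or_gt R (rho L q) with h | h
    · rw [(hR q h).2]
      simp only [zero_apply, abs_zero]
      have := rho_nonneg q
      positivity
    · refine ((fderiv ℝ φ q).le_opNorm _).trans ?_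
      rw [mul_assoc]
      refine mul_le_mul (hC q) ?_ (norm_nonneg _) hC0
      have h1 := norm_dilGen_le q
      have h2 := four_mul_abs_snd_le q
      have h3 := (hcb q).trans (mul_le_mul_of_nonneg_left (sqrt_hsq_le_rho q) hc0)
      nlinarith [rho_nonneg q]
  · refine ((fderiv ℝ φ q).le_opNorm _).trans ?_
    rw [mul_assoc]
    refine mul_le_mul (hC q) ((norm_rotGen_le q).trans ((hcb q).trans ?_)) (norm_nonneg _) hC0
    exact mul_le_mul_of_nonneg_right (by linarith) (Real.sqrt_nonneg _)

/-- The flux of `ρ^{-Q} ‖∇₀ ρ‖^p Z`, where `Z` generates the dilations. -/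
theorem integral_fderiv_dilGen_weight (hL : ∀ j, L j ≠ 0) {φ : AnisoHeis L → ℝ}
    (hφ : ContDiff ℝ ∞ φ) (hc : HasCompactSupport φ) {p : ℝ} (hp : 0 < p) :
    Integrable (fun q => rho L q ^ (-homDim L) * slope L q ^ p * fderiv ℝ φ q (dilGen L q)) ∧
    ∫ q, rho L q ^ (-homDim L) * slope L q ^ p * fderiv ℝ φ q (dilGen L q)
      = -(homDim L * ∫ q in {q | rho L q < 1}, slope L q ^ p) * φ 1 := by
  have hi : Integrable
      (fun q => rho L q ^ (-homDim L) * slope L q ^ p * fderiv ℝ φ q (dilGen L q)) := by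
    obtain ⟨R, -, -, -, hR, -⟩ := exists_bounds hφ hc
    obtain ⟨C, hC0, hC⟩ := abs_fderiv_dilGen_le hL hφ hc
    refine integrable_of_le hL (R := R) (C := C) ?_ (fun q hq => ?_) fun q hq => ?_
    · exact (((continuous_rho L).measurable.pow_const _).mul
        ((measurable_slope L).pow_const _)).mul (continuous_fderiv_apply hφ _).measurable
    · rw [(hR q hq).2]; simp
    · have hρ := rho_pos hL hq
      rw [abs_mul, abs_mul, abs_of_nonneg (Real.rpow_nonneg hρ.le _),
        abs_of_nonneg (Real.rpow_nonneg (slope_nonneg q) _)]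
      have h1 := Real.rpow_le_one (slope_nonneg q) (slope_le_one q) hp.le
      have h2 := Real.rpow_nonneg hρ.le (-homDim L)
      calc _ ≤ rho L q ^ (-homDim L) * 1 * (C * rho L q) :=
            mul_le_mul (mul_le_mul_of_nonneg_left h1 h2) (hC q).1 (abs_nonneg _) (by simpa using h2)
        _ = C * rho L q ^ (1 - homDim L) := by
            rw [sub_eq_neg_add, Real.rpow_add hρ, Real.rpow_one]; ring
  refine ⟨hi, ?_⟩
  obtain ⟨h1, h2⟩ := integral_polar hL hi
  rw [h2, polarBase, integral_prod _ h1, ← integral_const_mul, ← integral_neg, ← integral_mul_const]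
  refine integral_congr_ae ?_
  filter_upwards [ae_restrict_of_ae ae_ne_one] with q hq
  have hρ := rho_pos hL hq
  -- The slope is constant along rays and `ρ^{-Q}` cancels against the density, leaving `r⁻¹ Zφ`,
  -- the radial derivative of `φ`.
  have h3 : ∀ r ∈ Ioi (0 : ℝ), polarDensity L (q, r) * (rho L (dil L r q) ^ (-homDim L) *
      slope L (dil L r q) ^ p * fderiv ℝ φ (dil L r q) (dilGen L (dil L r q)))
      = homDim L * slope L q ^ p *
        (r⁻¹ * fderiv ℝ φ (dil L r q) (dilGen L (dil L r q))) := fun r hr => by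
    have hr : 0 < r := hr
    rw [slope_dil hr, rho_dil hr.le, polarDensity, Real.mul_rpow hr.le hρ.le,
      Real.rpow_sub hr, Real.rpow_one, Real.rpow_neg hr.le, Real.rpow_neg hρ.le]
    have := (Real.rpow_pos_of_pos hr (homDim L)).ne'
    have := (Real.rpow_pos_of_pos hρ (homDim L)).ne'
    field_simp
  rw [setIntegral_congr_fun measurableSet_Ioi h3, integral_const_mul,
    integral_fderiv_dilGen hL hφ hc hq]
  ring

/-- The contribution of the rotations vanishes. -/
theorem integral_fderiv_rotGen_weight (hL : ∀ j, L j ≠ 0) {φ : AnisoHeis L → ℝ}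
    (hφ : ContDiff ℝ ∞ φ) (hc : HasCompactSupport φ) {p : ℝ} (hp : 1 < p) :
    Integrable (fun q => 4 * q.2 * rho L q ^ (-homDim L - 2) * slope L q ^ (p - 2) *
      fderiv ℝ φ q (rotGen q)) ∧
    ∫ q, 4 * q.2 * rho L q ^ (-homDim L - 2) * slope L q ^ (p - 2) *
      fderiv ℝ φ q (rotGen q) = 0 := by
  have hm : Measurable fun q : AnisoHeis L =>
      4 * q.2 * rho L q ^ (-homDim L - 2) * slope L q ^ (p - 2) :=
    (((sndL L).continuous.measurable.const_mul 4).mul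
      ((continuous_rho L).measurable.pow_const _)).mul ((measurable_slope L).pow_const _)
  have hi : Integrable (fun q => 4 * q.2 * rho L q ^ (-homDim L - 2) * slope L q ^ (p - 2) *
      fderiv ℝ φ q (rotGen q)) := by
    obtain ⟨R, -, -, -, hR, -⟩ := exists_bounds hφ hc
    obtain ⟨C, hC0, hC⟩ := abs_fderiv_dilGen_le hL hφ hc
    refine integrable_of_le hL (R := R) (C := C) ?_ (fun q hq => ?_) fun q hq => ?_
    · exact hm.mul (continuous_fderiv_apply hφ _).measurable
    · rw [(hR q hq).2]; simp
    · have hρ := rho_pos hL hq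
      rw [abs_mul, abs_mul, abs_mul, abs_mul, abs_of_nonneg (Real.rpow_nonneg hρ.le _),
        abs_of_nonneg (Real.rpow_nonneg (slope_nonneg q) _), abs_of_pos (four_pos (α := ℝ))]
      have h2 := Real.rpow_nonneg hρ.le (-homDim L - 2)
      have h3 := Real.rpow_nonneg (slope_nonneg q) (p - 2)
      have hs : Real.sqrt (hsq L q) = slope L q * rho L q := by rw [slope]; field_simp
      -- For `p < 2` the power `σ^{p-2}` blows up at `s = 0`; one factor `σ` from `√s = σρ` raises
      -- the exponent to `p - 1 > 0`.
      have h4 : slope L q ^ (p - 2) * slope L q ≤ 1 := by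
        rcases (slope_nonneg q).eq_or_lt with h | h
        · rw [← h, mul_zero]; exact zero_le_one
        · rw [← Real.rpow_add_one h.ne']
          exact Real.rpow_le_one h.le (slope_le_one q) (by linarith)
      calc _ ≤ rho L q ^ 2 * rho L q ^ (-homDim L - 2) * slope L q ^ (p - 2) *
              (C * Real.sqrt (hsq L q)) := by
            refine mul_le_mul ?_ (hC q).2 (abs_nonneg _) (by positivity)
            gcongr
            exact four_mul_abs_snd_le q
        _ = C * (rho L q ^ (2 : ℝ) * rho L q ^ (-homDim L - 2) * rho L q ^ (1 : ℝ)) *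
              (slope L q ^ (p - 2) * slope L q) := by
            rw [hs, Real.rpow_one, Real.rpow_two]; ring
        _ ≤ C * (rho L q ^ (2 : ℝ) * rho L q ^ (-homDim L - 2) * rho L q ^ (1 : ℝ)) * 1 := by
            gcongr
        _ = C * rho L q ^ (1 - homDim L) := by
            rw [← Real.rpow_add hρ, ← Real.rpow_add hρ, mul_one]
            ring_nf
  refine ⟨hi, integral_mul_fderiv_rotGen hL hφ hm (fun θ q => ?_) hi⟩
  rw [slope, slope, hsq_rot hL, rho_rot hL, rot_snd]

/-! ### Classical derivatives as weak derivatives -/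

theorem integral_XDeriv_eq_zero {ψ : AnisoHeis L → ℝ} (hψ : ContDiff ℝ ∞ ψ)
    (hc : HasCompactSupport ψ) (i : Fin n ⊕ Fin n) : ∫ q, XDeriv L i ψ q = 0 := by
  have hd := hψ.differentiable (by simp)
  have hcont : ∀ v, Continuous fun q => fderiv ℝ ψ q v := fun v =>
    (hψ.continuous_fderiv (by simp)).clm_apply continuous_const
  have hcs : ∀ v, HasCompactSupport fun q => fderiv ℝ ψ q v := fun v => hc.fderiv_apply ℝ v
  -- A coefficient constant along the direction `v` leaves no extra term in the integration by
  -- parts; this covers both the constant part of `X_i` and its vertical part.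
  have key : ∀ (f : AnisoHeis L → ℝ) (v : AnisoHeis L), Differentiable ℝ f →
      (∀ q, fderiv ℝ f q v = 0) → Integrable (fun q => f q * fderiv ℝ ψ q v) ∧
        ∫ q, f q * fderiv ℝ ψ q v = 0 := fun f v hf hfv => by
    have h1 : Integrable (fun q => f q * fderiv ℝ ψ q v) :=
      (hf.continuous.mul (hcont v)).integrable_of_hasCompactSupport (hcs v).mul_left
    have h2 : Integrable (fun q => f q * ψ q) :=
      (hf.continuous.mul hψ.continuous).integrable_of_hasCompactSupport hc.mul_left
    refine ⟨h1, ?_⟩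
    rw [integral_mul_fderiv_eq_neg_fderiv_mul_of_integrable (by simp [hfv]) h1 h2
      (fun _ _ => hf _) (fun _ _ => hd _)]
    simp [hfv]
  obtain ⟨i1, e1⟩ := key (fun _ => 1) (X L i 1) (differentiable_const _) (by simp)
  obtain ⟨i2, e2⟩ := key (fun q => (symp L).flip (X L i 1) q) (vert L 1)
    ((symp L).flip (X L i 1)).differentiable (fun q => by
      rw [ContinuousLinearMap.fderiv, ContinuousLinearMap.flip_apply, symp_apply]
      simp)
  have he : XDeriv L i ψ = fun q => 1 * fderiv ℝ ψ q (X L i 1)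
      + (symp L).flip (X L i 1) q * fderiv ℝ ψ q (vert L 1) := by
    ext q
    rw [XDeriv, X_eq, map_add, one_mul, ContinuousLinearMap.flip_apply, ← smul_eq_mul (a := symp L _ _),
      ← map_smul, ← map_smul, smul_eq_mul, mul_one]
  rw [he, integral_add i1 i2, e1, e2, add_zero]

theorem contDiff_mul_of_tsupport_subset {u φ : AnisoHeis L → ℝ}
    (hu : ∀ q ≠ 1, ContDiffAt ℝ ∞ u q) (hφ : ContDiff ℝ ∞ φ) (hs : tsupport φ ⊆ {1}ᶜ) :
    ContDiff ℝ ∞ fun q => u q * φ q := by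
  refine contDiff_iff_contDiffAt.2 fun q => ?_
  by_cases hq : q ∈ tsupport φ
  · exact (hu q (hs hq)).mul hφ.contDiffAt
  · have : (fun q => u q * φ q) =ᶠ[nhds q] fun _ => 0 := by
      filter_upwards [notMem_tsupport_iff_eventuallyEq.1 hq] with y hy
      rw [hy]
      simp
    exact contDiffAt_const.congr_of_eventuallyEq this

theorem isLpLoc_of_contDiffAt {u : AnisoHeis L → ℝ} (hu : ∀ q ≠ 1, ContDiffAt ℝ ∞ u q) (p : ℝ) :
    IsLpLoc L p {1}ᶜ u := by
  intro K hK hc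
  have hcont : ContinuousOn u K := fun q hq => (hu q (hK hq)).continuousAt.continuousWithinAt
  obtain ⟨C, hC⟩ := hc.exists_bound_of_continuousOn hcont
  have hfin : IsFiniteMeasure ((volume : Measure (AnisoHeis L)).restrict K) :=
    ⟨by rw [Measure.restrict_apply_univ]; exact hc.measure_lt_top⟩
  exact MemLp.of_bound (hcont.aestronglyMeasurable_of_isCompact hc hc.measurableSet) C
    ((ae_restrict_mem hc.measurableSet).mono hC)

/-- The classical horizontal derivatives are weak derivatives. -/
theorem hasWeakHorizontalDeriv_of_contDiffAt {u : AnisoHeis L → ℝ}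
    (hu : ∀ q ≠ 1, ContDiffAt ℝ ∞ u q) (p : ℝ) :
    HasWeakHorizontalDeriv L p {1}ᶜ u (fun i => XDeriv L i u) where
  isLpLoc := isLpLoc_of_contDiffAt hu p
  isLpLoc_deriv i := isLpLoc_of_contDiffAt (fun q hq => contDiffAt_XDeriv (hu q hq) i) p
  integral_eq := by
    rintro i φ ⟨hφ, hc, hs⟩
    have hXφ : ContDiff ℝ ∞ (XDeriv L i φ) :=
      contDiff_iff_contDiffAt.2 fun q => contDiffAt_XDeriv hφ.contDiffAt i
    have hsupp : tsupport (XDeriv L i φ) ⊆ tsupport φ := by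
      refine closure_minimal (fun q hq => ?_) (isClosed_tsupport φ)
      by_contra h
      exact hq (by rw [XDeriv, fderiv_of_notMem_tsupport ℝ h]; rfl)
    have hcX : HasCompactSupport (XDeriv L i φ) := hc.of_isClosed_subset (isClosed_tsupport _) hsupp
    have hψ := contDiff_mul_of_tsupport_subset hu hφ hs
    have h1 : Integrable fun q => u q * XDeriv L i φ q :=
      (contDiff_mul_of_tsupport_subset hu hXφ
        (hsupp.trans hs)).continuous.integrable_of_hasCompactSupport hcX.mul_left
    have h2 : Integrable fun q => XDeriv L i u q * φ q :=
      (contDiff_mul_of_tsupport_subset (fun q hq => contDiffAt_XDeriv (hu q hq) i) hφ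
        hs).continuous.integrable_of_hasCompactSupport hc.mul_left
    have h3 := integral_XDeriv_eq_zero hψ hc.mul_left i
    have h4 : XDeriv L i (fun q => u q * φ q)
        = fun q => u q * XDeriv L i φ q + XDeriv L i u q * φ q := by
      ext q
      by_cases hq : q ∈ tsupport φ
      · have := ((hu q (hs hq)).differentiableAt (by simp)).hasFDerivAt.fun_mul
          (hφ.differentiable (by simp) q).hasFDerivAt
        rw [XDeriv, this.fderiv, add_apply, smul_apply, smul_apply, smul_eq_mul, smul_eq_mul,
          mul_comm (φ q)]
        rfl
      · have hq' : q ∉ tsupport fun q => u q * φ q := fun h => hq (tsupport_mul_subset_right h)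
        rw [XDeriv, fderiv_of_notMem_tsupport ℝ hq', XDeriv, fderiv_of_notMem_tsupport ℝ hq,
          image_eq_zero_of_notMem_tsupport hq]
        simp
    rw [h4, integral_add h1 h2] at h3
    linarith

/-! ### The gradient and the flux of `Γ_p` -/

theorem gradInner_smul_left (c : ℝ) (d e : Fin n ⊕ Fin n → ℝ) :
    gradInner L (fun i => c * d i) e = c * gradInner L d e := by
  rw [gradInner, gradInner, Finset.mul_sum]
  exact Finset.sum_congr rfl fun i _ => by ring

theorem gradNorm_smul {c : ℝ} (hc : 0 ≤ c) (d : Fin n ⊕ Fin n → ℝ) :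
    gradNorm L (fun i => c * d i) = c * gradNorm L d := by
  have : gradInner L (fun i => c * d i) (fun i => c * d i) = c ^ 2 * gradInner L d d := by
    rw [gradInner, gradInner, Finset.mul_sum]
    exact Finset.sum_congr rfl fun i _ => by ring
  rw [gradNorm, gradNorm, this, Real.sqrt_mul (sq_nonneg c), Real.sqrt_sq hc]

theorem gradNorm_rho (hL : ∀ j, L j ≠ 0) {q : AnisoHeis L} (hq : q ≠ 1) :
    gradNorm L (fun i => XDeriv L i (rho L) q) = slope L q := by
  rw [gradNorm, gradInner_rho_self hL hq, Real.sqrt_div (hsq_nonneg q),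
    Real.sqrt_sq (rho_nonneg q), slope]

theorem omegaP_eq (hL : ∀ j, L j ≠ 0) (p : ℝ) :
    omegaP L p = ∫ q in {q | rho L q < 1}, slope L q ^ p := by
  refine integral_congr_ae ?_
  filter_upwards [ae_restrict_of_ae ae_ne_one] with q hq
  rw [gradNorm_rho hL hq]

theorem omegaP_pos (hn : 1 ≤ n) (hL : ∀ j, L j ≠ 0) {p : ℝ} (hp : 0 < p) : 0 < omegaP L p := by
  have hnn : ∀ q, 0 ≤ slope L q ^ p := fun q => Real.rpow_nonneg (slope_nonneg q) p
  rw [omegaP_eq hL, setIntegral_pos_iff_support_of_nonneg_ae (Filter.Eventually.of_forall hnn)]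
  · refine lt_of_lt_of_le (IsOpen.measure_pos (U := {q : AnisoHeis L | 0 < hsq L q} ∩
      {q | rho L q < 1}) volume ?_ ?_) (measure_mono (inter_subset_inter_left _ fun q hq => ?_))
    · exact (isOpen_lt continuous_const (contDiff_hsq L).continuous).inter
        (isOpen_lt (continuous_rho L) continuous_const)
    · set q₀ : AnisoHeis L := X L (.inl ⟨0, hn⟩) 1
      have h0 : 0 < hsq L q₀ := by
        refine lt_of_le_of_ne (hsq_nonneg _) fun h => ?_
        have := congrFun ((hsq_eq_zero hL).1 h.symm) (.inl ⟨0, hn⟩)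
        simp [q₀] at this
      have h1 := rho_nonneg q₀
      -- Dilating a point with `s > 0` by `1/(ρ + 1)` brings it into the unit ball and keeps `s >
      -- 0`.
      refine ⟨dil L (1 / (rho L q₀ + 1)) q₀, ?_, ?_⟩
      · change 0 < hsq L _
        rw [hsq_dil]
        positivity
      · change rho L _ < 1
        rw [rho_dil (by positivity), one_div, inv_mul_eq_div, div_lt_one (by positivity)]
        linarith
    · have hq : 0 < hsq L q := hq
      have h1 := (Real.sqrt_pos.2 hq).trans_le (sqrt_hsq_le_rho q)
      exact (Real.rpow_pos_of_pos (div_pos (Real.sqrt_pos.2 hq) h1) p).ne'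
  · refine Integrable.mono' (integrableOn_const (C := (1 : ℝ)) (volume_rho_lt_one hL).ne)
      ((measurable_slope L).pow_const p).aestronglyMeasurable
      (Filter.Eventually.of_forall fun q => ?_)
    rw [Real.norm_eq_abs, abs_of_nonneg (hnn q)]
    exact Real.rpow_le_one (slope_nonneg q) (slope_le_one q) hp.le

theorem GammaP_of_ne {p : ℝ} (hp : p ≠ homDim L) :
    GammaP L p = fun q => constP L p * rho L q ^ ((p - homDim L) / (p - 1)) := by
  ext q; rw [GammaP, if_neg hp]

theorem contDiffAt_GammaP (hL : ∀ j, L j ≠ 0) (p : ℝ) {q : AnisoHeis L} (hq : q ≠ 1) :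
    ContDiffAt ℝ ∞ (GammaP L p) q := by
  have hρ := (rho_pos hL hq).ne'
  by_cases hp : p = homDim L
  · have : GammaP L p = fun q => constP L p * Real.log (rho L q) := by
      ext q; rw [GammaP, if_pos hp]
    rw [this]
    exact contDiffAt_const.mul ((contDiffAt_rho hL hq).log hρ)
  · rw [GammaP_of_ne hp]
    exact contDiffAt_const.mul ((contDiffAt_rho hL hq).rpow_const_of_ne hρ)

variable (L) in
/-- The derivative of `Γ_p` as a function of `ρ`. -/
def radialDeriv (p : ℝ) (q : AnisoHeis L) : ℝ :=
  (homDim L * omegaP L p) ^ (-1 / (p - 1)) * rho L q ^ ((1 - homDim L) / (p - 1))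

/-- The factor `(p-1)/(p-Q)` in `C_p` cancels the exponent, so the power and logarithmic cases share
one radial derivative and need no further distinction. -/
theorem XDeriv_GammaP (hL : ∀ j, L j ≠ 0) {p : ℝ} (hp1 : 1 < p) {q : AnisoHeis L} (hq : q ≠ 1)
    (i : Fin n ⊕ Fin n) :
    XDeriv L i (GammaP L p) q = radialDeriv L p q * XDeriv L i (rho L) q := by
  have hρ := (rho_pos hL hq).ne'
  have hd := (differentiableAt_rho hL hq).hasFDerivAt
  have hp0 : p - 1 ≠ 0 := by linarith
  by_cases hp : p = homDim L
  · have : GammaP L p = fun q => constP L p * Real.log (rho L q) := by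
      ext q; rw [GammaP, if_pos hp]
    rw [this, XDeriv, ((hd.log hρ).const_mul _).fderiv, constP, if_pos hp, radialDeriv,
      show (1 - homDim L) / (p - 1) = -1 by rw [← hp]; field_simp; ring, Real.rpow_neg_one,
      smul_apply, smul_apply, smul_eq_mul, smul_eq_mul, mul_assoc]
    rfl
  · have hp2 : p - homDim L ≠ 0 := sub_ne_zero.2 hp
    rw [GammaP_of_ne hp, XDeriv, ((hd.rpow_const (Or.inl hρ)).const_mul _).fderiv, constP,
      if_neg hp, radialDeriv, show (p - homDim L) / (p - 1) - 1 = (1 - homDim L) / (p - 1) by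
        field_simp; ring, smul_apply, smul_apply, smul_eq_mul, smul_eq_mul, XDeriv]
    field_simp

theorem radialDeriv_pos (hn : 1 ≤ n) (hL : ∀ j, L j ≠ 0) {p : ℝ} (hp1 : 1 < p) {q : AnisoHeis L}
    (hq : q ≠ 1) : 0 < radialDeriv L p q :=
  mul_pos (Real.rpow_pos_of_pos (mul_pos homDim_pos (omegaP_pos hn hL (by linarith))) _)
    (Real.rpow_pos_of_pos (rho_pos hL hq) _)

theorem radialDeriv_rpow (hn : 1 ≤ n) (hL : ∀ j, L j ≠ 0) {p : ℝ} (hp1 : 1 < p) (q : AnisoHeis L) :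
    radialDeriv L p q ^ (p - 1) = (homDim L * omegaP L p)⁻¹ * rho L q ^ (1 - homDim L) := by
  have hp0 : p - 1 ≠ 0 := by linarith
  have h1 := (mul_pos (homDim_pos (L := L)) (omegaP_pos hn hL (show 0 < p by linarith))).le
  rw [radialDeriv, Real.mul_rpow (Real.rpow_nonneg h1 _) (Real.rpow_nonneg (rho_nonneg q) _),
    ← Real.rpow_mul h1, ← Real.rpow_mul (rho_nonneg q), div_mul_cancel₀ _ hp0,
    div_mul_cancel₀ _ hp0, Real.rpow_neg_one]

theorem gradNorm_GammaP (hn : 1 ≤ n) (hL : ∀ j, L j ≠ 0) {p : ℝ} (hp1 : 1 < p) {q : AnisoHeis L}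
    (hq : q ≠ 1) :
    gradNorm L (fun i => XDeriv L i (GammaP L p) q) = radialDeriv L p q * slope L q := by
  simp only [XDeriv_GammaP hL hp1 hq]
  rw [gradNorm_smul (radialDeriv_pos hn hL hp1 hq).le, gradNorm_rho hL hq]

theorem locallyIntegrable_gradNorm_GammaP (hn : 1 ≤ n) (hL : ∀ j, L j ≠ 0) {p : ℝ} (hp1 : 1 < p) :
    LocallyIntegrable
      (fun q => gradNorm L (fun i => XDeriv L i (GammaP L p) q) ^ (p - 1)) := by
  refine locallyIntegrable_iff.2 fun K hK => ?_
  obtain ⟨R, hR⟩ := hK.bddAbove_image (continuous_rho L).continuousOn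
  have hm : Measurable fun q => (homDim L * omegaP L p)⁻¹ * rho L q ^ (1 - homDim L) *
      slope L q ^ (p - 1) :=
    (((continuous_rho L).measurable.pow_const _).const_mul _).mul ((measurable_slope L).pow_const _)
  have h1 := (integrableOn_rho_rpow hL (R + 1)).const_mul (homDim L * omegaP L p)⁻¹
  have h0 : 0 < homDim L * omegaP L p :=
    mul_pos (homDim_pos (L := L)) (omegaP_pos hn hL (show 0 < p by linarith))
  have h2 : IntegrableOn (fun q => (homDim L * omegaP L p)⁻¹ * rho L q ^ (1 - homDim L) *
      slope L q ^ (p - 1)) {q | rho L q < R + 1} := by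
    refine Integrable.mono' h1 hm.aestronglyMeasurable (Filter.Eventually.of_forall fun q => ?_)
    have h3 := Real.rpow_nonneg (rho_nonneg q) (1 - homDim L)
    have h4 := Real.rpow_nonneg (slope_nonneg q) (p - 1)
    rw [Real.norm_eq_abs, abs_of_nonneg (by positivity)]
    exact mul_le_of_le_one_right (by positivity)
      (Real.rpow_le_one (slope_nonneg q) (slope_le_one q) (by linarith))
  refine (h2.mono_set fun q hq => ?_).congr ?_
  · have := hR ⟨q, hq, rfl⟩
    change rho L q < R + 1
    linarith
  · filter_upwards [ae_restrict_of_ae ae_ne_one] with q hq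
    rw [gradNorm_GammaP hn hL hp1 hq, Real.mul_rpow (radialDeriv_pos hn hL hp1 hq).le
      (slope_nonneg q), radialDeriv_rpow hn hL hp1]

/-- The `(p-1)`-st power of the radial derivative is `(Qω_p)⁻¹ ρ^{1-Q}`; what remains is the
splitting of `∇₀ρ`, rewritten through `s = σ²ρ²`. -/
theorem flux_eq (hn : 1 ≤ n) (hL : ∀ j, L j ≠ 0) {p : ℝ} (hp1 : 1 < p) (φ : AnisoHeis L → ℝ)
    {q : AnisoHeis L} (hq : q ≠ 1) :
    gradNorm L (fun i => XDeriv L i (GammaP L p) q) ^ (p - 2) *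
        gradInner L (fun i => XDeriv L i (GammaP L p) q) (fun i => XDeriv L i φ q)
      = (homDim L * omegaP L p)⁻¹ *
        (rho L q ^ (-homDim L) * slope L q ^ p * fderiv ℝ φ q (dilGen L q)
          + 4 * q.2 * rho L q ^ (-homDim L - 2) * slope L q ^ (p - 2) *
            fderiv ℝ φ q (rotGen q)) := by
  have hρ := rho_pos hL hq
  have hc := radialDeriv_pos hn hL hp1 hq
  rw [gradNorm_GammaP hn hL hp1 hq]
  simp only [XDeriv_GammaP hL hp1 hq]
  rw [gradInner_smul_left, gradInner_eq_fderiv, hgrad_rho hL hq, map_add, map_smul, map_smul,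
    smul_eq_mul, smul_eq_mul, Real.mul_rpow hc.le (slope_nonneg q)]
  have h1 : radialDeriv L p q ^ (p - 2) * radialDeriv L p q
      = (homDim L * omegaP L p)⁻¹ * rho L q ^ (1 - homDim L) := by
    rw [← radialDeriv_rpow hn hL hp1, ← Real.rpow_add_one hc.ne']
    ring_nf
  -- Where the slope vanishes the exponents cannot be added; there both sides are zero, whatever
  -- value `0 ^ (p - 2)` has.
  have h2 : slope L q ^ (p - 2) * slope L q ^ 2 = slope L q ^ p := by
    rcases (slope_nonneg q).eq_or_lt with h | h
    · rw [← h, Real.zero_rpow (show p ≠ 0 by linarith)]; simp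
    · rw [← Real.rpow_two, ← Real.rpow_add h]
      ring_nf
  have h3 : hsq L q = slope L q ^ 2 * rho L q ^ 2 := by
    rw [slope, div_pow, Real.sq_sqrt (hsq_nonneg q)]
    field_simp
  have h4 : rho L q ^ (1 - homDim L) = rho L q ^ (-homDim L) * rho L q := by
    rw [← Real.rpow_add_one hρ.ne']
    ring_nf
  have h5 : rho L q ^ (-homDim L - 2) = rho L q ^ (-homDim L) / rho L q ^ 2 := by
    rw [Real.rpow_sub hρ, Real.rpow_two]
  rw [h4] at h1
  rw [h3, h5, ← h2]
  have e : ∀ a b c d : ℝ, (a * b) * (c * d) = (a * c) * (b * d) := fun a b c d => by ring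
  rw [e, h1]
  field_simp

/-- `Γ_p` is a fundamental solution of the `p`-Laplace equation. -/
theorem isFundamentalSolution_GammaP (hn : 1 ≤ n) (hL : ∀ j, L j ≠ 0) {p : ℝ} (hp1 : 1 < p) :
    IsFundamentalSolution L p 1 (GammaP L p) := by
  refine ⟨fun i => XDeriv L i (GammaP L p),
    hasWeakHorizontalDeriv_of_contDiffAt (fun q hq => contDiffAt_GammaP hL p hq) p,
    locallyIntegrable_gradNorm_GammaP hn hL hp1, ?_⟩
  rintro φ ⟨hφ, hc, -⟩
  obtain ⟨i1, e1⟩ := integral_fderiv_dilGen_weight hL hφ hc (show 0 < p by linarith)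
  obtain ⟨i2, e2⟩ := integral_fderiv_rotGen_weight hL hφ hc hp1
  rw [integral_congr_ae (ae_ne_one.mono fun q hq => flux_eq hn hL hp1 φ hq), integral_const_mul,
    integral_add i1 i2, e1, e2, ← omegaP_eq hL, add_zero, neg_mul, mul_neg,
    inv_mul_cancel_left₀]
  exact (mul_pos homDim_pos (omegaP_pos hn hL (by linarith))).ne'

/-! ### Polarizability -/

theorem XDeriv_const_mul (c : ℝ) (f : AnisoHeis L → ℝ) (i : Fin n ⊕ Fin n) :
    XDeriv L i (fun q => c * f q) = fun q => c * XDeriv L i f q := by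
  ext q
  have : (fun q => c * f q) = c • f := rfl
  rw [XDeriv, this, fderiv_const_smul_field]
  rfl

theorem infLaplacian_const_mul (c : ℝ) (f : AnisoHeis L → ℝ) (q : AnisoHeis L) :
    infLaplacian L (fun q => c * f q) q = c ^ 3 * infLaplacian L f q := by
  simp only [infLaplacian, XDeriv_const_mul, Finset.mul_sum]
  exact Finset.sum_congr rfl fun i _ => Finset.sum_congr rfl fun j _ => by ring

theorem isPolarizable (hn : 1 ≤ n) (hL : ∀ j, L j ≠ 0) : IsPolarizable L := by
  have hn' : (1 : ℝ) ≤ n := by exact_mod_cast hn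
  have hQ : 2 < homDim L := by unfold homDim; linarith
  set B : ℝ := -constP L 2 with hB
  have hBpos : 0 < B := by
    have h0 : 0 < (homDim L * omegaP L 2) ^ (-1 / ((2 : ℝ) - 1)) :=
      Real.rpow_pos_of_pos (mul_pos homDim_pos (omegaP_pos hn hL two_pos)) _
    -- `C_2` is negative because `2 < Q`, so `B = -C_2` is positive.
    have h1 : 0 < (2 - 1) / (homDim L - 2) := div_pos (by norm_num) (by linarith)
    rw [hB, constP, if_neg hQ.ne, ← neg_mul, ← div_neg, neg_sub]
    exact mul_pos h1 h0
  have hu : ∀ q, -GammaP L 2 q = B * rho L q ^ (2 - homDim L) := fun q => by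
    rw [GammaP_of_ne hQ.ne, hB, show (2 - homDim L) / (2 - 1) = 2 - homDim L by ring]
    ring
  refine ⟨fun q => -GammaP L 2 q, ⟨?_, ?_, ?_, ?_⟩, ?_⟩
  · exact fun q hq => (contDiffAt_GammaP hL 2 hq).neg.contDiffWithinAt
  · intro q hq
    rw [hu]
    exact mul_pos hBpos (Real.rpow_pos_of_pos (rho_pos hL hq) _)
  · intro r hr q hq
    rw [hu, hu, rho_dil hr.le, Real.mul_rpow hr.le (rho_nonneg q)]
    ring
  · simp only [neg_neg]
    exact isFundamentalSolution_GammaP hn hL one_lt_two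
  · intro q hq
    -- The equality of functions holds at the identity too, where both sides are zero because `0` to
    -- a nonzero power is `0`.
    have hN : (fun y => (-GammaP L 2 y) ^ (1 / (2 - homDim L)))
        = fun y => B ^ (1 / (2 - homDim L)) * rho L y := by
      ext y
      rw [hu, Real.mul_rpow hBpos.le (Real.rpow_nonneg (rho_nonneg y) _),
        ← Real.rpow_mul (rho_nonneg y), mul_one_div_cancel (by linarith), Real.rpow_one]
    rw [hN, infLaplacian_const_mul, infLaplacian_rho hL hq, mul_zero]

end AnisoHeis

theorem mainTheorem1 (n : ℕ) (hn : 1 ≤ n) (L : Fin n → ℝ) (hL : ∀ j, L j ≠ 0) :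
    -- the fields `X_i` and `T` are the left-invariant fields of the group
    (∀ i q, mulInvariantVectorField (I := 𝓘(ℝ, AnisoHeis L))
        (AnisoHeis.X L i 1 : AnisoHeis.Alg L) q = AnisoHeis.X L i q) ∧
    (∀ q, mulInvariantVectorField (I := 𝓘(ℝ, AnisoHeis L))
        (AnisoHeis.T L 1 : AnisoHeis.Alg L) q = AnisoHeis.T L q) ∧
    -- the group is a group of Heisenberg type for the given metric
    IsCarnotGroup 𝓘(ℝ, AnisoHeis L) (AnisoHeis L) 2 (AnisoHeis.layer L) ∧
    IsHeisenbergTypeInner (AnisoHeis.metric L) ∧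
    -- `Γ_p` is the fundamental solution
    (∀ p : ℝ, 1 < p → AnisoHeis.IsFundamentalSolution L p 1 (AnisoHeis.GammaP L p)) ∧
    -- `Δ_∞ ρ = 0` off the identity
    ContDiffOn ℝ ∞ (AnisoHeis.rho L) {1}ᶜ ∧
    (∀ q : AnisoHeis L, q ≠ 1 → AnisoHeis.infLaplacian L (AnisoHeis.rho L) q = 0) ∧
    -- the group is polarizable
    AnisoHeis.IsPolarizable L := by
  exact ⟨AnisoHeis.mulInvariantVectorField_X L, AnisoHeis.mulInvariantVectorField_T L,
    AnisoHeis.isCarnotGroup hn hL, AnisoHeis.isHeisenbergTypeInner hn hL,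
    fun _ hp => AnisoHeis.isFundamentalSolution_GammaP hn hL hp,
    fun _ hq => (AnisoHeis.contDiffAt_rho hL hq).contDiffWithinAt,
    fun _ hq => AnisoHeis.infLaplacian_rho hL hq, AnisoHeis.isPolarizable hn hL⟩
end
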